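/- Let $g$ be a natural number and let $H_{\mathbb Q}$ be the $\mathbb Q$-vector space with basis $a_1,\dots,a_g,b_1,\dots,b_g$. Let $T(H_{\mathbb Q})=\bigoplus_{n\ge 1}H_{\mathbb Q}^{\otimes n}$ be the free associative algebra without constant terms on $H_{\mathbb Q}$, and put $\omega_0=\sum_{i=1}^g(a_i\otimes b_i-b_i\otimes a_i)$. Let $\mathfrak a_g$ be the Lie algebra, with bracket $[F,G]=F\circ G-G\circ F$, of all $\mathbb Q$-linear derivations $D$ of $T(H_{\mathbb Q})$ with $D(\omega_0)=0$. For $k\ge 0$ let $\mathfrak a_g(k)\subset\mathfrak a_g$ be the subspace of those $D$ with $D(H_{\mathbb Q})\subset H_{\mathbb Q}^{\otimes(k+1)}$, and let $\mathfrak a_g^+=\bigoplus_{k\ge 1}\mathfrak a_g(k)$. For $k\ge 1$ the weight-$k$ part of the abelianization $H_1(\mathfrak a_g^+)=\mathfrak a_g^+/[\mathfrak a_g^+,\mathfrak a_g^+]$ is $$H_1(\mathfrak a_g^+)_k=\mathfrak a_g(k)\Big/\sum_{i+j=k,\ i,j\ge 1}[\mathfrak a_g(i),\mathfrak a_g(j)],$$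 where $[\mathfrak a_g(i),\mathfrak a_g(j)]$ denotes the span of the brackets. Theorem. If $g\ge k+3\ge 6$, then $H_1(\mathfrak a_g^+)_k=0$. Equivalently, $\mathfrak a_g^+$ is generated as a Lie algebra in degrees up to $g-3$ by $\mathfrak a_g(1)$ and $\mathfrak a_g(2)$: for every $k$ with $1\le k\le g-3$, the subspace $\mathfrak a_g(k)$ is contained in the Lie subalgebra of $\mathfrak a_g^+$ generated by $\mathfrak a_g(1)\cup\mathfrak a_g(2)$. -/

import Mathlib

noncomputable section

namespace SympDer

attribute [local instance 100] LieRing.ofAssociativeRing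

/-- The free associative algebra without constant terms `T(H_ℚ) = ⨁_{n ≥ 1} H_ℚ^{⊗ n}`, where `H_ℚ`
has the basis `a_1, …, a_g` (left summand) and `b_1, …, b_g` (right summand): it has as a basis the
nonempty words in these `2 g` letters, and the product is concatenation of words. -/
abbrev T (g : ℕ) : Type := MonoidAlgebra ℚ (FreeSemigroup (Fin g ⊕ Fin g))

/-- The basis vector `a_i` of `H_ℚ`. -/
def a {g : ℕ} (i : Fin g) : T g := MonoidAlgebra.single (FreeSemigroup.of (Sum.inl i)) 1

/-- The basis vector `b_i` of `H_ℚ`. -/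
def b {g : ℕ} (i : Fin g) : T g := MonoidAlgebra.single (FreeSemigroup.of (Sum.inr i)) 1

/-- `H_ℚ^{⊗ n}` inside `T(H_ℚ)`: the span of the words of length `n` (it is `0` for `n = 0`). -/
def tensorPower (g n : ℕ) : Submodule ℚ (T g) :=
  Submodule.span ℚ {x | ∃ w : FreeSemigroup (Fin g ⊕ Fin g),
    w.length = n ∧ x = MonoidAlgebra.single w 1}

/-- The symplectic element `ω₀ = ∑ (a_i ⊗ b_i - b_i ⊗ a_i)`. -/
def omega (g : ℕ) : T g := ∑ i : Fin g, (a i * b i - b i * a i)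

/-- The Lie algebra `Der(T(H_ℚ))` of derivations, a Lie subalgebra of the `ℚ`-linear endomorphisms
with the commutator bracket `F ∘ G - G ∘ F`. -/
def Der (g : ℕ) : LieSubalgebra ℚ (Module.End ℚ (T g)) where
  carrier := {D | ∀ x y : T g, D (x * y) = D x * y + x * D y}
  add_mem' {D E} hD hE x y := by
    rw [LinearMap.add_apply, hD x y, hE x y, LinearMap.add_apply, LinearMap.add_apply,
      add_mul, mul_add]
    abel
  zero_mem' x y := by simp
  smul_mem' c D hD x y := by
    rw [LinearMap.smul_apply, hD x y, LinearMap.smul_apply, LinearMap.smul_apply,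
      smul_add, smul_mul_assoc, mul_smul_comm]
  lie_mem' {D E} hD hE x y := by
    have hD' : ∀ x y : T g, D (x * y) = D x * y + x * D y := hD
    have hE' : ∀ x y : T g, E (x * y) = E x * y + x * E y := hE
    simp only [LieRing.of_associative_ring_bracket, LinearMap.sub_apply, Module.End.mul_apply,
      hD', hE', map_add, sub_mul, mul_sub]
    abel

/-- The Lie algebra `𝔞_g` of symplectic derivations: those derivations `D` with `D(ω₀) = 0`. -/
def symp (g : ℕ) : LieSubalgebra ℚ (Module.End ℚ (T g)) where
  carrier := {D | D ∈ Der g ∧ D (omega g) = 0}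
  add_mem' {D E} hD hE := ⟨(Der g).add_mem hD.1 hE.1, by simp [hD.2, hE.2]⟩
  zero_mem' := ⟨(Der g).zero_mem, by simp⟩
  smul_mem' c D hD := ⟨(Der g).smul_mem c hD.1, by simp [hD.2]⟩
  lie_mem' {D E} hD hE := ⟨(Der g).lie_mem hD.1 hE.1, by
    simp [LieRing.of_associative_ring_bracket, Module.End.mul_apply, hD.2, hE.2]⟩

/-- The degree `k` part `𝔞_g(k) ⊆ Hom(H_ℚ, H_ℚ^{⊗ (k+1)})`: a derivation is determined by its
restriction to `H_ℚ`, and it has degree `k` if this restriction takes values in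
`H_ℚ^{⊗ (k+1)}`. -/
def sympDeg (g k : ℕ) : Submodule ℚ (symp g) where
  carrier := {D | ∀ x ∈ tensorPower g 1, (D : Module.End ℚ (T g)) x ∈ tensorPower g (k + 1)}
  add_mem' hD hE x hx := (tensorPower g (k + 1)).add_mem (hD x hx) (hE x hx)
  zero_mem' _ _ := (tensorPower g (k + 1)).zero_mem
  smul_mem' c _ hD x hx := (tensorPower g (k + 1)).smul_mem c (hD x hx)

/-- The product of `H_ℚ^{⊗ m}` and `H_ℚ^{⊗ n}` lies in `H_ℚ^{⊗ (m+n)}`. -/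
theorem mul_mem_tensorPower {g m n : ℕ} {x y : T g} (hx : x ∈ tensorPower g m)
    (hy : y ∈ tensorPower g n) : x * y ∈ tensorPower g (m + n) := by
  induction hx using Submodule.span_induction with
  | mem x hx =>
    obtain ⟨v, hv, rfl⟩ := hx
    induction hy using Submodule.span_induction with
    | mem y hy =>
      obtain ⟨w, hw, rfl⟩ := hy
      refine Submodule.subset_span ⟨v * w, ?_, ?_⟩
      · rw [FreeSemigroup.length_mul, hv, hw]
      · rw [MonoidAlgebra.single_mul_single, mul_one]
    | zero => rw [mul_zero]; exact Submodule.zero_mem _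
    | add y z _ _ hy hz => rw [mul_add]; exact Submodule.add_mem _ hy hz
    | smul c y _ hy => rw [mul_smul_comm]; exact Submodule.smul_mem _ c hy
  | zero => rw [zero_mul]; exact Submodule.zero_mem _
  | add y z _ _ hy hz => rw [add_mul]; exact Submodule.add_mem _ hy hz
  | smul c y _ hy => rw [smul_mul_assoc]; exact Submodule.smul_mem _ c hy

/-- A derivation of degree `k` maps every `H_ℚ^{⊗ n}` to `H_ℚ^{⊗ (n+k)}`. -/
theorem apply_mem_tensorPower {g k : ℕ} {D : symp g} (hD : D ∈ sympDeg g k) {n : ℕ} {x : T g}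
    (hx : x ∈ tensorPower g n) : (D : Module.End ℚ (T g)) x ∈ tensorPower g (n + k) := by
  have key : ∀ w : FreeSemigroup (Fin g ⊕ Fin g),
      (D : Module.End ℚ (T g)) (MonoidAlgebra.single w 1) ∈ tensorPower g (w.length + k) := by
    intro w
    induction w using FreeSemigroup.recOnMul with
    | ih1 l =>
      rw [FreeSemigroup.length_of, add_comm]
      exact hD _ (Submodule.subset_span ⟨_, FreeSemigroup.length_of l, rfl⟩)
    | ih2 v w hv hw =>
      have h : (MonoidAlgebra.single (FreeSemigroup.of v * w) 1 : T g)
          = MonoidAlgebra.single (FreeSemigroup.of v) 1 * MonoidAlgebra.single w 1 := by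
        rw [MonoidAlgebra.single_mul_single, mul_one]
      rw [h, D.2.1, FreeSemigroup.length_mul]
      refine Submodule.add_mem _ ?_ ?_
      · have := mul_mem_tensorPower hv
          (Submodule.subset_span ⟨w, rfl, rfl⟩ : MonoidAlgebra.single w 1 ∈ tensorPower g w.length)
        rwa [add_right_comm] at this
      · have := mul_mem_tensorPower (Submodule.subset_span ⟨FreeSemigroup.of v, rfl, rfl⟩ :
          MonoidAlgebra.single (FreeSemigroup.of v) 1 ∈
            tensorPower g (FreeSemigroup.of v).length) hw
        rwa [← add_assoc] at this
  induction hx using Submodule.span_induction with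
  | mem x hx => obtain ⟨w, rfl, rfl⟩ := hx; exact key w
  | zero => rw [map_zero]; exact Submodule.zero_mem _
  | add y z _ _ hy hz => rw [map_add]; exact Submodule.add_mem _ hy hz
  | smul c y _ hy => rw [map_smul]; exact Submodule.smul_mem _ c hy

/-- `[𝔞_g(k), 𝔞_g(l)] ⊆ 𝔞_g(k+l)`. -/
theorem lie_mem_sympDeg {g k l : ℕ} {D E : symp g} (hD : D ∈ sympDeg g k)
    (hE : E ∈ sympDeg g l) : ⁅D, E⁆ ∈ sympDeg g (k + l) := by
  intro x hx
  have h : ((⁅D, E⁆ : symp g) : Module.End ℚ (T g)) x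
      = (D : Module.End ℚ (T g)) ((E : Module.End ℚ (T g)) x)
        - (E : Module.End ℚ (T g)) ((D : Module.End ℚ (T g)) x) := by
    rw [LieSubalgebra.coe_bracket, LieRing.of_associative_ring_bracket]
    rfl
  rw [h]
  refine Submodule.sub_mem _ ?_ ?_
  · have := apply_mem_tensorPower hD (hE x hx)
    rwa [show l + 1 + k = k + l + 1 by omega] at this
  · have := apply_mem_tensorPower hE (hD x hx)
    rwa [show k + 1 + l = k + l + 1 by omega] at this

/-- The Lie subalgebra `𝔞_g⁺ = ⨁_{k ≥ 1} 𝔞_g(k)` of `𝔞_g`. -/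
def sympPos (g : ℕ) : LieSubalgebra ℚ (symp g) where
  toSubmodule := ⨆ k : ℕ, sympDeg g (k + 1)
  lie_mem' {D E} hD hE := by
    change ⁅D, E⁆ ∈ ⨆ k : ℕ, sympDeg g (k + 1)
    change D ∈ ⨆ k : ℕ, sympDeg g (k + 1) at hD
    change E ∈ ⨆ k : ℕ, sympDeg g (k + 1) at hE
    induction hD using Submodule.iSup_induction' with
    | mem k D hD =>
      induction hE using Submodule.iSup_induction' with
      | mem l E hE =>
        have := lie_mem_sympDeg hD hE
        rw [show k + 1 + (l + 1) = (k + l + 1) + 1 by omega] at this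
        exact Submodule.mem_iSup_of_mem (k + l + 1) this
      | zero => rw [lie_zero]; exact Submodule.zero_mem _
      | add E F _ _ hE hF => rw [lie_add]; exact Submodule.add_mem _ hE hF
    | zero => rw [zero_lie]; exact Submodule.zero_mem _
    | add D F _ _ hD hF => rw [add_lie]; exact Submodule.add_mem _ hD hF

/-- The subspace `∑_{i+j=k, i,j ≥ 1} [𝔞_g(i), 𝔞_g(j)]` of `𝔞_g(k)`, where `[𝔞_g(i), 𝔞_g(j)]` is the
span of the brackets. -/
def brackets (g k : ℕ) : Submodule ℚ (symp g) :=
  Submodule.span ℚ {F | ∃ i j : ℕ, 1 ≤ i ∧ 1 ≤ j ∧ i + j = k ∧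
    ∃ D E : symp g, D ∈ sympDeg g i ∧ E ∈ sympDeg g j ∧ F = ⁅D, E⁆}

/-- The brackets of total degree `k` indeed lie in `𝔞_g(k)`. -/
theorem brackets_le_sympDeg (g k : ℕ) : brackets g k ≤ sympDeg g k := by
  refine Submodule.span_le.2 ?_
  rintro F ⟨i, j, -, -, rfl, D, E, hD, hE, rfl⟩
  exact lie_mem_sympDeg hD hE

/-- The weight `k` part `H_1(𝔞_g⁺)_k` of the abelianization of `𝔞_g⁺`, for `k ≥ 1`: the quotient of
`𝔞_g(k)` by `∑_{i+j=k, i,j ≥ 1} [𝔞_g(i), 𝔞_g(j)]`. -/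
abbrev H1SympPos (g k : ℕ) : Type :=
  sympDeg g k ⧸ (brackets g k).submoduleOf (sympDeg g k)

end SympDer

end

/-! A symplectic derivation of degree `k` is a rational combination of cyclic words of length `k +
2`: the symplectic form turns it into a rotation-invariant tensor, and one divides by the number of
rotations (`coe_mem_of_cycDer_mem`). The bracket of two cyclic words contracts a letter of one with
a letter of the other in all ways and glues the remainders (`lie_cycDer`). So it suffices that for
`k ≥ 3` every cyclic word of length `k + 2` is a combination of brackets (`cls_eq_zero`).

This goes by downward induction on the number of distinct indices in the word. As `g ≥ k + 3`, some
index `z` is always fresh. Bracketing `u z` with `z̄ v` expresses `u v` through words in which a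
pair `x` in `u`, `x̄` in `v` is replaced by a pair `z`, `z̄`. If the index of `x` also occurs
elsewhere, the number of indices has grown and the term vanishes by induction. Otherwise the pair is
isolated, and the action of degree `0` derivations allows `z` to be renamed to `x`. What remains is
a relation among rearrangements of one word (`cls_cut`): with the isolated pairs drawn as chords of
a circle, a word equals the sum of its regluings along the chords that cross a given cut. Exchanging
two chords preserves the class and reversing one changes its sign (`cls_swap`, `cls_flip`).
`ChordFunctional` axiomatizes this situation and `positionFunctional` realizes it.

The rest is combinatorics of chords (`ChordFunctional.val_eq_zero`). Closed arcs slide along chords,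
and a word vanishes if a closed arc and its complement both have at least two letters. Nests of
blocks `y x ȳ _ x̄` are the main tool: a word with a nest enlarged by one block is a positive
multiple of a word with the shorter nest (`Extends.nest`), and without torsion the multiple can be
cancelled. Absorbing chords into ever longer nests leaves a few shapes, each of which vanishes by
closed arcs, by parallel chords, or by being its own negative. Five letters are needed, hence `k ≥
3`. -/

noncomputable section

namespace SympDer

attribute [local instance 100] LieRing.ofAssociativeRing

/-! ### Sums over the letters of a word. -/

/-- The sum of `F l x r` over all ways of writing a word as `l ++ x :: r`. -/
def splitSum {α M : Type*} [AddCommMonoid M] : List α → (List α → α → List α → M) → M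
  | [], _ => 0
  | x :: w, F => F [] x w + splitSum w fun l y r => F (x :: l) y r

section SplitSum

variable {α M : Type*} [AddCommMonoid M]

@[simp] theorem splitSum_nil (F : List α → α → List α → M) : splitSum [] F = 0 := rfl

@[simp] theorem splitSum_cons (x : α) (w : List α) (F : List α → α → List α → M) :
    splitSum (x :: w) F = F [] x w + splitSum w fun l y r => F (x :: l) y r := rfl

theorem splitSum_append (u v : List α) (F : List α → α → List α → M) :
    splitSum (u ++ v) F
      = splitSum u (fun l x r => F l x (r ++ v)) + splitSum v (fun l x r => F (u ++ l) x r) := by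
  induction u generalizing F with
  | nil => simp
  | cons a u ih => simp [ih, add_assoc]

theorem splitSum_congr {w : List α} {F G : List α → α → List α → M}
    (h : ∀ l x r, w = l ++ x :: r → F l x r = G l x r) : splitSum w F = splitSum w G := by
  induction w generalizing F G with
  | nil => rfl
  | cons a w ih =>
    rw [splitSum_cons, splitSum_cons, h [] a w rfl,
      ih fun l x r e => h (a :: l) x r (by rw [e]; rfl)]

theorem splitSum_eq_zero {w : List α} {F : List α → α → List α → M}
    (h : ∀ l x r, w = l ++ x :: r → F l x r = 0) : splitSum w F = 0 := by
  induction w generalizing F with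
  | nil => rfl
  | cons a w ih =>
    rw [splitSum_cons, h [] a w rfl, ih fun l x r e => h (a :: l) x r (by rw [e]; rfl), add_zero]

theorem splitSum_add (w : List α) (F G : List α → α → List α → M) :
    splitSum w (fun l x r => F l x r + G l x r) = splitSum w F + splitSum w G := by
  induction w generalizing F G with
  | nil => simp
  | cons a w ih => simp only [splitSum_cons, ih]; abel

theorem map_splitSum {N Φ : Type*} [AddCommMonoid N] [FunLike Φ M N] [AddMonoidHomClass Φ M N]
    (φ : Φ) (w : List α) (F : List α → α → List α → M) :
    φ (splitSum w F) = splitSum w fun l x r => φ (F l x r) := by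
  induction w generalizing F with
  | nil => simp
  | cons a w ih => simp only [splitSum_cons, map_add, ih]

theorem splitSum_comm {β : Type*} (u : List α) (v : List β)
    (F : List α → α → List α → List β → β → List β → M) :
    splitSum u (fun l x r => splitSum v fun l' y r' => F l x r l' y r')
      = splitSum v fun l' y r' => splitSum u fun l x r => F l x r l' y r' := by
  induction u generalizing F with
  | nil => exact (splitSum_eq_zero fun _ _ _ _ => rfl).symm
  | cons a u ih => simp only [splitSum_cons, ih, splitSum_add]

/-- Choosing two letters of a word, the left one first or the right one first. -/
theorem splitSum_splitSum (w : List α) (F : List α → α → List α → α → List α → M) :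
    splitSum w (fun l x r => splitSum r fun m y r' => F l x m y r')
      = splitSum w fun l y r => splitSum l fun l' x m => F l' x m y r := by
  induction w generalizing F with
  | nil => rfl
  | cons a w ih =>
    simp only [splitSum_cons, splitSum_nil, zero_add, splitSum_add]
    rw [ih fun l x m y r' => F (a :: l) x m y r']

theorem splitSum_ite_not_mem [DecidableEq α] {w : List α} {b : α} (hb : b ∉ w)
    (G : List α → α → List α → M) :
    splitSum w (fun l y r => if y = b then G l y r else 0) = 0 := by
  refine splitSum_eq_zero fun l x r e => if_neg ?_
  rintro rfl
  exact hb (by simp [e])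

theorem splitSum_ite_mem [DecidableEq α] {l r : List α} {b : α} (hl : b ∉ l) (hr : b ∉ r)
    (G : List α → α → List α → M) :
    splitSum (l ++ b :: r) (fun l y r => if y = b then G l y r else 0) = G l b r := by
  rw [splitSum_append, splitSum_cons, if_pos rfl,
    splitSum_ite_not_mem hl fun l y r' => G l y (r' ++ b :: r),
    splitSum_ite_not_mem hr fun l' y r' => G (l ++ b :: l') y r']
  simp

end SplitSum

/-! ### Chord functionals and their first relations. -/

/-- A function on words in the letters of `α` that behaves like the class of a cyclic word modulo
brackets. The involution `bar` pairs the two ends of every chord and fixes the free letters; only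
the words in which every letter occurs once have a nonzero value. -/
structure ChordFunctional (α M : Type*) [DecidableEq α] [AddCommGroup M] where
  bar : α → α
  bar_bar : ∀ x, bar (bar x) = x
  size : ℕ
  val : List α → M
  nodup_of_ne : ∀ w, val w ≠ 0 → w.Nodup
  mem_of_ne : ∀ w, val w ≠ 0 → ∀ x, x ∈ w
  length_of_ne : ∀ w, val w ≠ 0 → w.length = size
  cyc : ∀ u v, val (u ++ v) = val (v ++ u)
  -- Abstract form of the bracket of `u z` with `z̄ v`, where the fresh pair `z` has taken over the
  -- name of the contracted chord. Both parts need two letters so that both factors have positive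
  -- degree.
  cut : ∀ u v, 2 ≤ u.length → 2 ≤ v.length → val (u ++ v) =
    splitSum u fun l x r => splitSum v fun l' y r' =>
      if y = bar x then val (x :: (l' ++ (r ++ y :: (l ++ r')))) else 0
  relabel : ∀ x y w, bar x ≠ x → bar y ≠ y → y ≠ x → y ≠ bar x →
    val (w.map (Equiv.swap x y * Equiv.swap (bar x) (bar y))) = val w
  flip : ∀ x w, bar x ≠ x → val (w.map (Equiv.swap x (bar x))) = - val w

namespace ChordFunctional

variable {α M : Type*} [DecidableEq α] [AddCommGroup M] (C : ChordFunctional α M)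

theorem val_eq_zero_of_not_nodup {w : List α} (h : ¬ w.Nodup) : C.val w = 0 := by
  by_contra h'
  exact h (C.nodup_of_ne w h')

/-- A word is closed if it contains with an end of a chord also the other end. -/
def Closed (p : List α) : Prop := ∀ x ∈ p, C.bar x ∈ p

variable {C}

theorem Closed.perm {p q : List α} (hp : C.Closed p) (h : p.Perm q) : C.Closed q :=
  fun x hx => h.mem_iff.1 (hp x (h.mem_iff.2 hx))

theorem Closed.nil : C.Closed [] := fun _ h => absurd h List.not_mem_nil

theorem Closed.chord {p : List α} (x : α) (hp : C.Closed p) : C.Closed (x :: C.bar x :: p) := by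
  intro y hy
  rcases List.mem_cons.1 hy with rfl | hy
  · simp
  rcases List.mem_cons.1 hy with rfl | hy
  · simp [C.bar_bar]
  · simp [hp y hy]

theorem Closed.bar_not_mem {p v : List α} (hp : C.Closed p) (h : (p ++ v).Nodup) {x : α}
    (hx : x ∈ p) : C.bar x ∉ v :=
  fun h' => (List.disjoint_of_nodup_append h) (hp x hx) h'

variable (C)

/-- A cut that crosses no chord. -/
theorem val_closed_append {u v : List α} (hu : C.Closed u) (h1 : 2 ≤ u.length)
    (h2 : 2 ≤ v.length) : C.val (u ++ v) = 0 := by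
  by_cases hn : (u ++ v).Nodup
  · rw [C.cut u v h1 h2]
    refine splitSum_eq_zero fun l x r e => ?_
    exact splitSum_ite_not_mem (hu.bar_not_mem hn (by simp [e]))
      fun l' y r' => C.val (x :: (l' ++ (r ++ y :: (l ++ r'))))
  · exact C.val_eq_zero_of_not_nodup hn

/-- A closed arc anywhere in a word. -/
theorem val_closed_middle {u s t : List α} (hu : C.Closed u) (h1 : 2 ≤ u.length)
    (h2 : 2 ≤ s.length + t.length) : C.val (s ++ (u ++ t)) = 0 := by
  rw [C.cyc, List.append_assoc]
  exact C.val_closed_append hu h1 (by simp; omega)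

/-- A cut that crosses a single chord. -/
theorem val_transfer {p q : List α} (hpq : C.Closed (p ++ q)) (e : α) (r₁ r₂ : List α) :
    C.val (p ++ e :: (q ++ (r₁ ++ C.bar e :: r₂)))
      = C.val (e :: (r₁ ++ (q ++ C.bar e :: (p ++ r₂)))) := by
  by_cases hn : (p ++ e :: (q ++ (r₁ ++ C.bar e :: r₂))).Nodup
  swap
  · rw [C.val_eq_zero_of_not_nodup hn, C.val_eq_zero_of_not_nodup]
    refine fun h => hn ((List.Perm.nodup_iff ?_).1 h)
    rw [List.perm_iff_count]; intro a; simp [List.count_cons]; omega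
  -- The cut needs two letters on both sides; in the two degenerate cases the claim is trivial or a
  -- rotation.
  by_cases h1 : p ++ q = []
  · obtain ⟨rfl, rfl⟩ := List.append_eq_nil_iff.1 h1
    simp
  by_cases h2 : r₁ ++ r₂ = []
  · obtain ⟨rfl, rfl⟩ := List.append_eq_nil_iff.1 h2
    simpa using C.cyc p (e :: (q ++ [C.bar e]))
  have h1' := List.length_pos_iff.2 h1
  have h2' := List.length_pos_iff.2 h2
  rw [List.length_append] at h1' h2'
  have hd : (p ++ e :: (q ++ (r₁ ++ C.bar e :: r₂)))
      = (p ++ e :: q) ++ (r₁ ++ C.bar e :: r₂) := by simp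
  have hperm : ((p ++ q) ++ (e :: (r₁ ++ C.bar e :: r₂))).Nodup := by
    refine (List.Perm.nodup_iff ?_).1 hn
    rw [List.perm_iff_count]; intro a; simp [List.count_cons]; omega
  have hcl : ∀ x ∈ p ++ q, C.bar x ∉ r₁ ++ C.bar e :: r₂ := fun x hx h =>
    hpq.bar_not_mem hperm hx (List.mem_cons_of_mem _ h)
  have hv : (r₁ ++ C.bar e :: r₂).Nodup := by
    rw [hd] at hn; exact hn.of_append_right
  have hv' := List.nodup_append'.1 hv
  have hv2 := List.nodup_cons.1 hv'.2.1
  -- Since `p ++ q` is closed, `e` is the only chord leaving `p ++ e :: q`, so one term of the cut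
  -- survives.
  rw [hd, C.cut _ _ (by simp; omega) (by simp; omega), splitSum_append, splitSum_cons,
    splitSum_ite_mem (fun h => hv'.2.2 h (by simp)) hv2.1
      fun l' y r' => C.val (e :: (l' ++ (q ++ y :: (p ++ [] ++ r')))),
    splitSum_eq_zero, splitSum_eq_zero]
  · simp
  · intro l x r h
    exact splitSum_ite_not_mem (hcl x (by simp [h])) fun l' y r' =>
      C.val (x :: (l' ++ (r ++ y :: (p ++ e :: l ++ r'))))
  · intro l x r h
    exact splitSum_ite_not_mem (hcl x (by simp [h])) fun l' y r' =>
      C.val (x :: (l' ++ ((r ++ e :: q) ++ y :: (l ++ r'))))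

/-- A cut around two ends of different chords with a closed arc between them. -/
theorem val_two {F : List α} (hF : C.Closed F) {x y : α} {v l₁ r₁ l₂ r₂ : List α}
    (h1 : v = l₁ ++ C.bar x :: r₁) (h2 : v = l₂ ++ C.bar y :: r₂) (hv : 2 ≤ v.length) :
    C.val (x :: (F ++ y :: v)) = C.val (x :: (l₁ ++ (F ++ y :: C.bar x :: r₁)))
      + C.val (y :: (l₂ ++ C.bar y :: x :: (F ++ r₂))) := by
  by_cases hn : (x :: (F ++ y :: v)).Nodup
  swap
  · rw [C.val_eq_zero_of_not_nodup hn, C.val_eq_zero_of_not_nodup, C.val_eq_zero_of_not_nodup,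
      add_zero]
    · refine fun h => hn ((List.Perm.nodup_iff ?_).1 h)
      rw [h2, List.perm_iff_count]; intro a; simp [List.count_cons]; omega
    · refine fun h => hn ((List.Perm.nodup_iff ?_).1 h)
      rw [h1, List.perm_iff_count]; intro a; simp [List.count_cons]; omega
  have hd : x :: (F ++ y :: v) = (x :: (F ++ [y])) ++ v := by simp
  have hperm : (F ++ (x :: y :: v)).Nodup := by
    refine (List.Perm.nodup_iff ?_).1 hn
    rw [List.perm_iff_count]; intro a; simp [List.count_cons]; omega
  have hcl : ∀ z ∈ F, C.bar z ∉ v := fun z hz h =>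
    hF.bar_not_mem hperm hz (by simp [h])
  have hv0 : v.Nodup := by
    rw [hd] at hn; exact hn.of_append_right
  have e1 : ∀ G : List α → α → List α → M,
      splitSum v (fun l z r => if z = C.bar x then G l z r else 0) = G l₁ (C.bar x) r₁ := by
    intro G
    have hv' := List.nodup_append'.1 (h1 ▸ hv0)
    rw [h1]
    exact splitSum_ite_mem (fun h => hv'.2.2 h (by simp)) (List.nodup_cons.1 hv'.2.1).1 G
  have e2 : ∀ G : List α → α → List α → M,
      splitSum v (fun l z r => if z = C.bar y then G l z r else 0) = G l₂ (C.bar y) r₂ := by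
    intro G
    have hv' := List.nodup_append'.1 (h2 ▸ hv0)
    rw [h2]
    exact splitSum_ite_mem (fun h => hv'.2.2 h (by simp)) (List.nodup_cons.1 hv'.2.1).1 G
  rw [hd, C.cut _ _ (by simp) hv, splitSum_cons, splitSum_append, splitSum_cons, splitSum_nil,
    e1 fun l' z r' => C.val (x :: (l' ++ ((F ++ [y]) ++ z :: ([] ++ r')))),
    e2 fun l' z r' => C.val (y :: (l' ++ ([] ++ z :: (x :: (F ++ []) ++ r')))), splitSum_eq_zero]
  · simp
  · intro l z r h
    exact splitSum_ite_not_mem (hcl z (by simp [h])) fun l' w r' =>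
      C.val (z :: (l' ++ ((r ++ [y]) ++ w :: (x :: l ++ r'))))

/-- Two parallel chords that do not cross each other and have at one side only closed arcs
between their ends. -/
theorem val_parallel {F : List α} (hF : C.Closed F) (x y : α) (s r : List α) :
    C.val (x :: (F ++ y :: (s ++ C.bar y :: C.bar x :: r))) = 0 := by
  -- In the first term the chord `y` encloses only `F`, in the second the chord `x` does; both terms
  -- contain a closed arc.
  rw [C.val_two hF (l₁ := s ++ [C.bar y]) (r₁ := r) (l₂ := s) (r₂ := C.bar x :: r)
    (by simp) rfl (by simp; omega)]
  have h1 := C.val_closed_middle (u := C.bar y :: (F ++ [y])) (s := x :: s) (t := C.bar x :: r)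
    ((hF.chord y).perm (by
      rw [List.perm_iff_count]; intro a; simp [List.count_cons]; omega)) (by simp) (by simp; omega)
  have h2 := C.val_closed_middle (u := x :: (F ++ [C.bar x])) (s := y :: (s ++ [C.bar y])) (t := r)
    ((hF.chord x).perm (by
      rw [List.perm_iff_count]; intro a; simp [List.count_cons])) (by simp) (by simp; omega)
  simp only [List.cons_append, List.append_assoc, List.nil_append] at h1 h2 ⊢
  rw [h1, h2, add_zero]

end ChordFunctional

/-! ### Nests of chords and the vanishing of chord functionals. -/

namespace ChordFunctional

variable {α M : Type*} [DecidableEq α] [AddCommGroup M] (C : ChordFunctional α M)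

/-- Renaming two chords into each other. -/
theorem val_swap_chords {x y : α} {r w w' : List α}
    (hp : w.Perm (x :: C.bar x :: y :: C.bar y :: r)) (hp' : w'.Perm w)
    (hw : ∀ τ : α → α, τ x = y → τ y = x → τ (C.bar x) = C.bar y → τ (C.bar y) = C.bar x →
      (∀ l, l ⊆ r → l.map τ = l) → w.map τ = w') : C.val w' = C.val w := by
  by_cases hn : w.Nodup
  swap
  · rw [C.val_eq_zero_of_not_nodup hn, C.val_eq_zero_of_not_nodup fun h => hn (hp'.nodup_iff.1 h)]
  have h := hp.nodup_iff.1 hn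
  simp only [List.nodup_cons, List.mem_cons, not_or] at h
  obtain ⟨⟨h1, h2, h3, h4⟩, ⟨h5, h6, h7⟩, ⟨h8, h9⟩, h10, -⟩ := h
  rw [← C.relabel x y w (Ne.symm h1) (Ne.symm h8) (Ne.symm h2) (Ne.symm h5)]
  congr 1
  refine (hw _ ?_ ?_ ?_ ?_ ?_).symm
  · simp [Equiv.swap_apply_of_ne_of_ne h1 h3]
  · simp [Equiv.swap_apply_of_ne_of_ne (Ne.symm h5) h8]
  · simp [Equiv.swap_apply_of_ne_of_ne (Ne.symm h3) (Ne.symm h8)]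
  · simp [Equiv.swap_apply_of_ne_of_ne (Ne.symm h1) h5]
  · intro l hl
    conv_rhs => rw [← List.map_id l]
    refine List.map_congr_left fun a ha => ?_
    have n1 : a ≠ x := by rintro rfl; exact h4 (hl ha)
    have n2 : a ≠ C.bar x := by rintro rfl; exact h7 (hl ha)
    have n3 : a ≠ y := by rintro rfl; exact h9 (hl ha)
    have n4 : a ≠ C.bar y := by rintro rfl; exact h10 (hl ha)
    simp [Equiv.swap_apply_of_ne_of_ne n2 n4, Equiv.swap_apply_of_ne_of_ne n1 n3]

/-- Reversing a chord. -/
theorem val_flip {x : α} {r w w' : List α}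
    (hp : w.Perm (x :: C.bar x :: r)) (hp' : w'.Perm w)
    (hw : ∀ τ : α → α, τ x = C.bar x → τ (C.bar x) = x →
      (∀ l, l ⊆ r → l.map τ = l) → w.map τ = w') : C.val w' = - C.val w := by
  by_cases hn : w.Nodup
  swap
  · rw [C.val_eq_zero_of_not_nodup hn, C.val_eq_zero_of_not_nodup fun h => hn (hp'.nodup_iff.1 h),
      neg_zero]
  have h := hp.nodup_iff.1 hn
  simp only [List.nodup_cons, List.mem_cons, not_or] at h
  obtain ⟨⟨h1, h2⟩, h3, -⟩ := h
  rw [← C.flip x w (Ne.symm h1)]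
  congr 1
  refine (hw _ ?_ ?_ ?_).symm
  · simp
  · simp
  · intro l hl
    conv_rhs => rw [← List.map_id l]
    refine List.map_congr_left fun a ha => ?_
    have n1 : a ≠ x := by rintro rfl; exact h2 (hl ha)
    have n2 : a ≠ C.bar x := by rintro rfl; exact h3 (hl ha)
    simp [Equiv.swap_apply_of_ne_of_ne n1 n2]

/-- The part to the left of the hole in the word with hole obtained from `p₀ _ q₀` by inserting,
from the outside to the inside, the words with hole `y x ȳ _ x̄`; the innermost one comes first in
the list of the pairs `(y, x)`. -/
def nestL (p₀ : List α) : List (α × α) → List α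
  | [] => p₀
  | c :: cs => nestL p₀ cs ++ [c.1, c.2, C.bar c.1]

/-- The part to the right of the hole, see `nestL`. -/
def nestR (q₀ : List α) : List (α × α) → List α
  | [] => q₀
  | c :: cs => C.bar c.2 :: nestR q₀ cs

@[simp] theorem nestL_nil (p₀ : List α) : C.nestL p₀ [] = p₀ := rfl

@[simp] theorem nestR_nil (p₀ : List α) : C.nestR p₀ [] = p₀ := rfl

theorem nestL_cons (p₀ : List α) (y x : α) (cs : List (α × α)) :
    C.nestL p₀ ((y, x) :: cs) = C.nestL p₀ cs ++ [y, x, C.bar y] := rfl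

theorem nestR_cons (q₀ : List α) (y x : α) (cs : List (α × α)) :
    C.nestR q₀ ((y, x) :: cs) = C.bar x :: C.nestR q₀ cs := rfl

theorem nestL_append (p q : List α) (cs : List (α × α)) :
    C.nestL (p ++ q) cs = p ++ C.nestL q cs := by
  induction cs with
  | nil => rfl
  | cons c cs ih => simp [nestL, ih]

theorem nestR_append (p q : List α) (cs : List (α × α)) :
    C.nestR (p ++ q) cs = C.nestR p cs ++ q := by
  induction cs with
  | nil => rfl
  | cons c cs ih => simp [nestR, ih]

variable {C} in
theorem Closed.nest {p₀ q₀ : List α} (h : C.Closed (p₀ ++ q₀)) (cs : List (α × α)) :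
    C.Closed (C.nestL p₀ cs ++ C.nestR q₀ cs) := by
  induction cs with
  | nil => exact h
  | cons c cs ih =>
    refine ((ih.chord c.1).chord c.2).perm ?_
    rw [List.perm_iff_count]; intro a; simp [List.count_cons, nestL, nestR]; omega

/-- The word with hole `p _ q` can be extended by a pair of chords in two ways; one is a multiple
of the other. -/
def Extends (p q : List α) (m : ℕ) : Prop := ∀ (y x : α) (E v : List α),
  m • C.val (p ++ y :: (q ++ x :: C.bar y :: (E ++ C.bar x :: v)))
    = C.val (p ++ y :: x :: C.bar y :: (E ++ C.bar x :: (q ++ v)))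

/-- The closed arc `F` slides along the chord `x` from one end to the other. -/
theorem extends_right {F : List α} (hF : C.Closed F) : C.Extends [] F 1 := by
  intro y x E v
  have h := C.val_transfer (p := []) (q := F) (by simpa using hF) (C.bar x) (v ++ [y])
    (C.bar y :: E)
  rw [C.bar_bar] at h
  have h1 := C.cyc (y :: x :: C.bar y :: E) (C.bar x :: (F ++ v))
  have h2 := C.cyc (C.bar x :: v) (y :: (F ++ x :: C.bar y :: E))
  simp only [List.cons_append, List.append_assoc, List.nil_append, one_smul] at h h1 h2 ⊢
  rw [h1, h, h2]

/-- A cut around `z̄ x` yields two terms, and the one containing the closed arc `z F y z̄ ȳ`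
vanishes. -/
theorem extends_chord {F : List α} (hF : C.Closed F) (z : α) :
    C.Extends (z :: F) [C.bar z] 1 := by
  intro y x E v
  have h1 := C.cyc (z :: (F ++ [y])) (C.bar z :: x :: C.bar y :: (E ++ C.bar x :: v))
  have h2 := C.cyc (z :: (F ++ [y])) (x :: C.bar y :: (E ++ C.bar x :: C.bar z :: v))
  have h3 := C.val_two (F := []) Closed.nil (x := C.bar z) (y := x)
    (v := C.bar y :: (E ++ C.bar x :: (v ++ z :: (F ++ [y]))))
    (l₁ := C.bar y :: (E ++ C.bar x :: v)) (r₁ := F ++ [y])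
    (l₂ := C.bar y :: E) (r₂ := v ++ z :: (F ++ [y])) (by simp [C.bar_bar]) (by simp)
    (by simp; omega)
  have h4 := C.cyc (C.bar z :: C.bar y :: (E ++ C.bar x :: (v ++ [x]))) (z :: (F ++ [y]))
  have h5 := C.val_closed_append (u := z :: (F ++ [y, C.bar z, C.bar y]))
    (v := E ++ C.bar x :: (v ++ [x])) (((hF.chord z).chord y).perm (by
      rw [List.perm_iff_count]; intro a; simp [List.count_cons]; omega)) (by simp)
      (by simp; omega)
  simp only [List.cons_append, List.append_assoc, List.nil_append, one_smul, C.bar_bar]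
    at h1 h2 h3 h4 h5 ⊢
  rw [h1, h2, h3, h4, h5, zero_add]

/-- The exceptional term in the recursion for extensions. -/
theorem val_exceptional (p q E v : List α) (y x₁ x₂ x₃ : α) :
    C.val (p ++ y :: (q ++ x₃ :: x₁ :: C.bar y :: x₂ :: C.bar x₁ :: C.bar x₂ ::
        (E ++ C.bar x₃ :: v)))
      = - C.val (p ++ y :: x₁ :: C.bar y :: x₂ :: C.bar x₁ :: (q ++ x₃ :: C.bar x₂ ::
        (E ++ C.bar x₃ :: v))) := by
  have hx₂ : C.Closed ([x₂] ++ [C.bar x₂]) := Closed.nil.chord x₂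
  have hx₂' : C.Closed ([C.bar x₂] ++ [x₂]) := by
    simpa [C.bar_bar] using (Closed.nil (C := C)).chord (C.bar x₂)
  -- moving the chord `x₂` from `C.bar x₁` to `x₁`
  have e1 := C.cyc (p ++ y :: (q ++ x₃ :: x₁ :: [C.bar y]))
    (x₂ :: C.bar x₁ :: C.bar x₂ :: (E ++ C.bar x₃ :: v))
  have e2 := C.val_transfer hx₂ (C.bar x₁) (E ++ C.bar x₃ :: (v ++ (p ++ y :: (q ++ [x₃]))))
    [C.bar y]
  -- moving the block of `C.bar y` to `y`
  have e3 := C.cyc (C.bar x₁ :: (E ++ C.bar x₃ :: (v ++ (p ++ y :: (q ++ [x₃])))))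
    (C.bar x₂ :: x₁ :: x₂ :: [C.bar y])
  have e4 := C.val_transfer (p := [C.bar x₂, x₁, x₂]) (q := [C.bar x₁])
    (((Closed.nil (C := C).chord x₁).chord x₂).perm (by
      rw [List.perm_iff_count]; intro a; simp [List.count_cons]; omega)) (C.bar y)
      (E ++ C.bar x₃ :: (v ++ p)) (q ++ [x₃])
  -- moving the chord `x₂` back
  have e5 := C.cyc (C.bar y :: (E ++ C.bar x₃ :: (v ++ (p ++ C.bar x₁ :: [y]))))
    (C.bar x₂ :: x₁ :: x₂ :: (q ++ [x₃]))
  have e6 := C.val_transfer hx₂' x₁ (q ++ x₃ :: C.bar y :: (E ++ C.bar x₃ :: (v ++ p))) [y]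
  have e7 := C.cyc (x₁ :: (q ++ x₃ :: C.bar y :: (E ++ C.bar x₃ :: v)))
    (p ++ x₂ :: C.bar x₁ :: C.bar x₂ :: [y])
  simp only [List.cons_append, List.append_assoc, List.nil_append, C.bar_bar]
    at e1 e2 e3 e4 e5 e6 e7
  rw [e1, e2, e3, e4, e5, e6, e7]
  -- The slides have reversed `x₁` and interchanged the roles of `x₂` and `y`. The reversal is the
  -- source of the sign.
  rw [C.val_flip (x := x₁) (r := p ++ (q ++ (E ++ (v ++ [x₂, C.bar x₂, y, C.bar y, x₃, C.bar x₃]))))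
    (w := p ++ x₂ :: x₁ :: C.bar x₂ :: y :: C.bar x₁ :: (q ++ x₃ :: C.bar y ::
        (E ++ C.bar x₃ :: v)))]
  rotate_left
  · rw [List.perm_iff_count]; intro a; simp [List.count_cons]; omega
  · rw [List.perm_iff_count]; intro a; simp [List.count_cons]; omega
  · intro τ h1 h2 h3
    have := h3 [x₂, C.bar x₂, y, C.bar y, x₃, C.bar x₃] (by intro a h; simp [h])
    simp only [List.map_cons, List.map_nil, List.cons.injEq] at this
    simp [h1, h2, h3 p (by intro a h; simp [h]), h3 q (by intro a h; simp [h]),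
      h3 E (by intro a h; simp [h]), h3 v (by intro a h; simp [h]), this]
  rw [neg_inj]
  apply C.val_swap_chords (x := x₂) (y := y)
    (r := p ++ (q ++ (E ++ (v ++ [x₁, C.bar x₁, x₃, C.bar x₃]))))
  · rw [List.perm_iff_count]; intro a; simp [List.count_cons]; omega
  · rw [List.perm_iff_count]; intro a; simp [List.count_cons]; omega
  · intro τ h1 h2 h1' h2' h3
    have := h3 [x₁, C.bar x₁, x₃, C.bar x₃] (by intro a h; simp [h])
    simp only [List.map_cons, List.map_nil, List.cons.injEq] at this
    simp [h1, h2, h1', h2', h3 p (by intro a h; simp [h]), h3 q (by intro a h; simp [h]),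
      h3 E (by intro a h; simp [h]), h3 v (by intro a h; simp [h]), this]

/-- The multiplicity grows by one with each block. Cutting around `x̄₁ x₃` splits the left word of
`k1` into the exceptional term, which is minus the right word of `k1`, and the left word of `k2`.
With multiplicity `n` for the shorter nest this reads `-n A + B = A`, so `B = (n + 1) A`. -/
theorem Extends.nest {p₀ q₀ : List α} (h : C.Extends p₀ q₀ 1) (cs : List (α × α)) :
    C.Extends (C.nestL p₀ cs) (C.nestR q₀ cs) (cs.length + 1) := by
  induction cs with
  | nil => simpa using h
  | cons c cs ih =>
    obtain ⟨y, x₁⟩ := c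
    intro x₂ x₃ E v
    rw [nestL_cons, nestR_cons, List.length_cons]
    set p := C.nestL p₀ cs
    set q := C.nestR q₀ cs
    have k1 := ih y x₁ [x₂] (x₃ :: C.bar x₂ :: (E ++ C.bar x₃ :: v))
    have k2 := ih y x₁ (x₂ :: x₃ :: C.bar x₂ :: (E ++ [C.bar x₃])) v
    have e1 := C.cyc (p ++ y :: (q ++ x₁ :: C.bar y :: [x₂]))
      (C.bar x₁ :: x₃ :: C.bar x₂ :: (E ++ C.bar x₃ :: v))
    have e2 := C.val_two (F := []) Closed.nil (x := C.bar x₁) (y := x₃)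
      (v := C.bar x₂ :: (E ++ C.bar x₃ :: (v ++ (p ++ y :: (q ++ x₁ :: C.bar y :: [x₂])))))
      (l₁ := C.bar x₂ :: (E ++ C.bar x₃ :: (v ++ (p ++ y :: q)))) (r₁ := C.bar y :: [x₂])
      (l₂ := C.bar x₂ :: E) (r₂ := v ++ (p ++ y :: (q ++ x₁ :: C.bar y :: [x₂])))
      (by simp [C.bar_bar]) (by simp) (by simp; omega)
    have e3 := C.cyc (C.bar x₁ :: C.bar x₂ :: (E ++ C.bar x₃ :: v))
      (p ++ y :: (q ++ x₃ :: x₁ :: C.bar y :: [x₂]))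
    have e4 := C.cyc (x₃ :: C.bar x₂ :: (E ++ C.bar x₃ :: C.bar x₁ :: v))
      (p ++ y :: (q ++ x₁ :: C.bar y :: [x₂]))
    have e5 := C.val_exceptional p q E v y x₁ x₂ x₃
    simp only [List.cons_append, List.append_assoc, List.nil_append, C.bar_bar]
      at k1 k2 e1 e2 e3 e4 e5 ⊢
    rw [e1, e2, e3, e4, e5, smul_add, smul_neg, k2] at k1
    rw [succ_nsmul]
    exact (neg_add_eq_iff_eq_add.1 k1).symm

end ChordFunctional

namespace ChordFunctional

variable {α M : Type*} [DecidableEq α] [AddCommGroup M] (C : ChordFunctional α M)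

theorem extends_nest_right {F : List α} (hF : C.Closed F) (cs : List (α × α)) :
    C.Extends (C.nestL [] cs) (C.nestR [] cs ++ F) (cs.length + 1) := by
  have h := (C.extends_right hF).nest C cs
  rwa [← List.nil_append F, nestR_append] at h

theorem extends_nest_chord {F : List α} (hF : C.Closed F) (z : α) (cs : List (α × α)) :
    C.Extends (z :: (F ++ C.nestL [] cs)) (C.nestR [] cs ++ [C.bar z]) (cs.length + 1) := by
  have h := (C.extends_chord hF z).nest C cs
  rw [← List.nil_append [C.bar z], nestR_append, ← List.append_nil (z :: F), nestL_append] at h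
  simpa using h

/-- Attaching a chord to a nest. -/
theorem val_nest_chord {F : List α} (hF : C.Closed F) (cs : List (α × α)) (y : α) (E v : List α) :
    C.val (C.nestL [] cs ++ y :: (C.nestR [] cs ++ (F ++ (E ++ C.bar y :: v))))
      = C.val (y :: (F ++ (C.nestL [] cs ++ (E ++ (C.nestR [] cs ++ C.bar y :: v))))) := by
  induction cs generalizing y E v with
  | nil => simp
  | cons c cs ih =>
    obtain ⟨y₁, y₂⟩ := c
    -- Both sides are compared with words for the shorter nest. The two extension rules have the
    -- same multiplicity `cs.length + 1`, so it need not be cancelled; only the names of the chords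
    -- differ in the end.
    have k1 := C.extends_nest_right hF cs y₁ y₂ [y] (E ++ C.bar y :: v)
    have k2 := C.extends_nest_chord hF y₁ cs y₂ y E v
    have k3 := ih y₁ [y₂] (y :: C.bar y₂ :: (E ++ C.bar y :: v))
    rw [nestL_cons, nestR_cons]
    set U := C.nestL [] cs
    set V := C.nestR [] cs
    simp only [List.cons_append, List.append_assoc, List.nil_append] at k1 k2 k3 ⊢
    rw [k3, k2] at k1
    rw [← k1]
    trans C.val (y :: (F ++ (U ++ y₂ :: y₁ :: C.bar y₂ :: (E ++ C.bar y₁ ::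
      (V ++ C.bar y :: v)))))
    · refine (C.val_swap_chords (x := y₁) (y := y)
        (r := F ++ (U ++ (E ++ (V ++ (v ++ [y₂, C.bar y₂]))))) ?_ ?_ ?_).symm
      · rw [List.perm_iff_count]; intro a; simp [List.count_cons]; omega
      · rw [List.perm_iff_count]; intro a; simp [List.count_cons]; omega
      · intro τ h1 h2 h1' h2' h3
        have := h3 [y₂, C.bar y₂] (by intro a h; simp [h])
        simp only [List.map_cons, List.map_nil, List.cons.injEq] at this
        simp [h1, h2, h1', h2', h3 F (by intro a h; simp [h]), h3 U (by intro a h; simp [h]),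
          h3 V (by intro a h; simp [h]),
          h3 E (by intro a h; simp [h]), h3 v (by intro a h; simp [h]), this]
    · refine (C.val_swap_chords (x := y₁) (y := y₂)
        (r := F ++ (U ++ (E ++ (V ++ (v ++ [y, C.bar y]))))) ?_ ?_ ?_).symm
      · rw [List.perm_iff_count]; intro a; simp [List.count_cons]; omega
      · rw [List.perm_iff_count]; intro a; simp [List.count_cons]; omega
      · intro τ h1 h2 h1' h2' h3
        have := h3 [y, C.bar y] (by intro a h; simp [h])
        simp only [List.map_cons, List.map_nil, List.cons.injEq] at this
        simp [h1, h2, h1', h2', h3 F (by intro a h; simp [h]), h3 U (by intro a h; simp [h]),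
          h3 V (by intro a h; simp [h]),
          h3 E (by intro a h; simp [h]), h3 v (by intro a h; simp [h]), this]

/-- A nest at a chord whose other end has at most a closed arc beside it. -/
theorem val_nest_end {F G : List α} (hF : C.Closed F) (hG : C.Closed G) {cs : List (α × α)}
    (hcs : cs ≠ []) (e : α) :
    C.val (C.nestL [] cs ++ e :: (C.nestR [] cs ++ (F ++ C.bar e :: G))) = 0 := by
  obtain ⟨⟨y₁, y₂⟩, cs, rfl⟩ := List.exists_cons_of_ne_nil hcs
  have k1 := C.extends_nest_right hF cs y₁ y₂ [e] (C.bar e :: G)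
  have k2 := C.val_nest_chord hF cs y₁ [y₂] (e :: C.bar y₂ :: C.bar e :: G)
  rw [nestL_cons, nestR_cons]
  set U := C.nestL [] cs
  set V := C.nestR [] cs
  have e1 := C.cyc (y₁ :: (F ++ (U ++ y₂ :: (V ++ C.bar y₁ :: e :: [C.bar y₂])))) (C.bar e :: G)
  -- After removal of the innermost block and a rotation, `e` and `y₁` are parallel chords with only
  -- `G` between two of their ends.
  have e2 := C.val_parallel hG (C.bar e) y₁ (F ++ (U ++ y₂ :: V)) [C.bar y₂]
  simp only [List.cons_append, List.append_assoc, List.nil_append, C.bar_bar] at k1 k2 e1 e2 ⊢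
  rw [← k1, k2, e1, e2, smul_zero]

/-- Attaching `y` to the nest, exchanging it with `e`, reversing `e` and sliding `F` back return to
the same word with the opposite sign. -/
theorem val_nest_pair [IsAddTorsionFree M] {F : List α} (hF : C.Closed F) (cs : List (α × α))
    (y e : α) : C.val (C.nestL [] cs ++ y :: (C.nestR [] cs ++ (F ++ e :: C.bar y :: [C.bar e])))
      = 0 := by
  have k := C.val_nest_chord hF cs y [e] [C.bar e]
  set U := C.nestL [] cs
  set V := C.nestR [] cs
  have e1 := C.cyc (U ++ y :: V) (F ++ e :: C.bar y :: [C.bar e])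
  have e2 := C.val_transfer (p := F) (q := []) (by simpa using hF) e [C.bar y] (U ++ y :: V)
  have e3 := C.cyc (e :: [C.bar y]) (C.bar e :: (F ++ (U ++ y :: V)))
  simp only [List.cons_append, List.append_assoc, List.nil_append] at k e1 e2 e3 ⊢
  have e4 : C.val (e :: (F ++ (U ++ y :: (V ++ C.bar e :: [C.bar y]))))
      = - C.val (C.bar e :: (F ++ (U ++ y :: (V ++ e :: [C.bar y])))) := by
    refine C.val_flip (x := e) (r := F ++ (U ++ (V ++ [y, C.bar y]))) ?_ ?_ ?_
    · rw [List.perm_iff_count]; intro a; simp [List.count_cons]; omega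
    · rw [List.perm_iff_count]; intro a; simp [List.count_cons]; omega
    · intro τ h1 h2 h3
      have := h3 [y, C.bar y] (by intro a h; simp [h])
      simp only [List.map_cons, List.map_nil, List.cons.injEq] at this
      simp [h1, h2, h3 F (by intro a h; simp [h]), h3 U (by intro a h; simp [h]),
        h3 V (by intro a h; simp [h]), this]
  have e5 : C.val (y :: (F ++ (U ++ e :: (V ++ C.bar y :: [C.bar e]))))
      = C.val (e :: (F ++ (U ++ y :: (V ++ C.bar e :: [C.bar y])))) := by
    refine C.val_swap_chords (x := e) (y := y) (r := F ++ (U ++ V)) ?_ ?_ ?_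
    · rw [List.perm_iff_count]; intro a; simp [List.count_cons]; omega
    · rw [List.perm_iff_count]; intro a; simp [List.count_cons]; omega
    · intro τ h1 h2 h1' h2' h3
      simp [h1, h2, h1', h2', h3 F (by intro a h; simp [h]), h3 U (by intro a h; simp [h]),
        h3 V (by intro a h; simp [h])]
  rw [e5, e4, ← e3, ← e2, ← e1] at k
  exact self_eq_neg.1 k

/-- A free letter can pass the left part of a nest. -/
theorem val_pass {f : α} (hf : C.bar f = f) (cs : List (α × α)) (A S : List α) :
    C.val (A ++ f :: (C.nestL [] cs ++ S)) = C.val (A ++ (C.nestL [] cs ++ f :: S)) := by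
  induction cs generalizing S with
  | nil => simp
  | cons c cs ih =>
    obtain ⟨y, x⟩ := c
    have k := ih (y :: x :: C.bar y :: S)
    rw [nestL_cons]
    set U := C.nestL [] cs
    have e1 := C.cyc (A ++ U) (f :: y :: x :: C.bar y :: S)
    -- A free letter is a closed arc, so it slides along `y` from before `y` to after `ȳ`.
    have e2 := C.val_transfer (p := [f]) (q := []) (by simp [Closed, hf]) y [x] (S ++ (A ++ U))
    have e3 := C.cyc (y :: x :: C.bar y :: f :: S) (A ++ U)
    simp only [List.cons_append, List.append_assoc, List.nil_append] at k e1 e2 e3 ⊢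
    rw [k, e1, e2, e3]

theorem val_free_adjacent {f g : α} (hf : C.bar f = f) (hg : C.bar g = g) {s t : List α}
    (h : 2 ≤ s.length + t.length) : C.val (s ++ f :: g :: t) = 0 :=
  C.val_closed_middle (u := [f, g]) (by simp [Closed, hf, hg]) (by simp) h

/-- Sliding `f` along `e` brings it next to `g`, and two adjacent free letters form a closed arc. -/
theorem val_nest_pair_free_right {f g : α} (hf : C.bar f = f) (hg : C.bar g = g)
    (cs : List (α × α)) (x e : α) (A : List α) :
    C.val (C.nestL [] cs ++ x :: (C.nestR [] cs ++ f :: e :: C.bar x :: (A ++ C.bar e :: [g])))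
      = 0 := by
  set U := C.nestL [] cs
  set V := C.nestR [] cs
  have e1 := C.cyc (U ++ x :: V) (f :: e :: C.bar x :: (A ++ C.bar e :: [g]))
  have e2 := C.val_transfer (p := [f]) (q := []) (by simp [Closed, hf]) e (C.bar x :: A)
    (g :: (U ++ x :: V))
  have e3 := C.val_free_adjacent hf hg (s := e :: C.bar x :: (A ++ [C.bar e])) (t := U ++ x :: V)
    (by simp; omega)
  simp only [List.cons_append, List.append_assoc, List.nil_append] at e1 e2 e3 ⊢
  rw [e1, e2, e3]

/-- Once `x` is attached to the nest, `f` can pass the nest and slide along `e` until it meets `g`,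
which has slid along `x`. -/
theorem val_nest_pair_free_left {f g : α} (hf : C.bar f = f) (hg : C.bar g = g)
    (cs : List (α × α)) (x e : α) :
    C.val (C.nestL [] cs ++ x :: (C.nestR [] cs ++ f :: e :: C.bar x :: g :: [C.bar e])) = 0 := by
  have k1 := C.val_nest_chord (F := [f]) (by simp [Closed, hf]) cs x [e] (g :: [C.bar e])
  have k2 := C.val_pass hf cs [C.bar x, C.bar e, g, x] (e :: C.nestR [] cs)
  set U := C.nestL [] cs
  set V := C.nestR [] cs
  have e1 := C.cyc (x :: f :: (U ++ e :: V)) (C.bar x :: g :: [C.bar e])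
  have e2 := C.val_transfer (p := []) (q := [g]) (by simp [Closed, hg]) (C.bar x) [C.bar e]
    (f :: (U ++ e :: V))
  have e3 := C.cyc (C.bar x :: C.bar e :: g :: x :: U) (f :: e :: V)
  have e4 := C.val_transfer (p := [f]) (q := []) (by simp [Closed, hf]) e (V ++ [C.bar x])
    (g :: x :: U)
  have e5 := C.val_free_adjacent hf hg (s := e :: (V ++ C.bar x :: [C.bar e])) (t := x :: U)
    (by simp; omega)
  simp only [List.cons_append, List.append_assoc, List.nil_append, C.bar_bar]
    at k1 k2 e1 e2 e3 e4 e5 ⊢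
  rw [k1, e1, e2, k2, e3, e4, e5]

/-- If all words with a longer nest vanish, then only few words with the given nest can be
nonzero. -/
theorem eq_nil_or_free_of_val_ne_zero {P Q A B : List α} (hPQ : C.Closed (P ++ Q)) {e : α}
    (H : ∀ t R, C.bar t ≠ t → C.val (P ++ e :: (Q ++ t :: C.bar e :: R)) = 0)
    (h : C.val (P ++ e :: (Q ++ (A ++ C.bar e :: B))) ≠ 0) :
    (A = [] ∨ ∃ g, C.bar g = g ∧ A = [g]) ∧ (B = [] ∨ ∃ g, C.bar g = g ∧ B = [g]) := by
  have hn := C.nodup_of_ne _ h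
  have hn1 : ((P ++ e :: (Q ++ [C.bar e])) ++ (A ++ B)).Nodup := by
    refine (List.Perm.nodup_iff ?_).1 hn
    rw [List.perm_iff_count]; intro a; simp [List.count_cons]; omega
  have hcl : C.Closed (P ++ e :: (Q ++ [C.bar e])) := (hPQ.chord e).perm (by
    rw [List.perm_iff_count]; intro a; simp [List.count_cons]; omega)
  have hz : ∀ a b c : M, a = 0 → b = 0 → c = 0 → a + (b + c) = 0 := by
    rintro a b c rfl rfl rfl; simp
  -- Cutting off `B`, only chords from `A` to `B` cross, because `P e Q ē` is closed. Regluing along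
  -- such a chord and sliding yields a word with a chord end directly before `ē`, which `H` kills.
  -- The argument for `A` is the same.
  have hB : ¬ 2 ≤ B.length := by
    intro hB
    apply h
    have hd : P ++ e :: (Q ++ (A ++ C.bar e :: B)) = ((P ++ e :: Q) ++ (A ++ [C.bar e])) ++ B := by
      simp
    rw [hd, C.cut _ _ (by simp; omega) hB, splitSum_append, splitSum_append A]
    refine hz _ _ _ ?_ ?_ ?_ <;>
      refine splitSum_eq_zero fun l x r hx => splitSum_eq_zero fun l' y r' hy => ?_ <;>
      split_ifs with hyx <;> try rfl
    all_goals subst hyx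
    · exact absurd (by simp [hy]) (hcl.bar_not_mem hn1 (x := x) (by
        have : x ∈ P ++ e :: Q := by rw [hx]; simp
        simp only [List.mem_append, List.mem_cons] at this ⊢; tauto))
    · have e1 := C.cyc (x :: (l' ++ r)) (C.bar e :: C.bar x :: (P ++ e :: (Q ++ (l ++ r'))))
      have e2 := C.val_transfer (p := [C.bar e]) (q := P ++ e :: Q) ((hPQ.chord e).perm (by
        rw [List.perm_iff_count]; intro a; simp [List.count_cons]; omega)) (C.bar x)
        (l ++ r') (l' ++ r)
      have e3 := C.cyc (C.bar x :: (l ++ r')) (P ++ e :: (Q ++ x :: C.bar e :: (l' ++ r)))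
      have e4 := H x (l' ++ (r ++ C.bar x :: (l ++ r'))) (by
        intro hxx
        have h1 : x ∈ A := by rw [hx]; simp
        have h2 : x ∈ B := by rw [hy, hxx]; simp
        exact List.disjoint_of_nodup_append hn1.of_append_right h1 h2)
      simp only [List.cons_append, List.append_assoc, List.nil_append, C.bar_bar] at e1 e2 e3 e4 ⊢
      rw [e1, e2, e3, e4]
    · exact absurd (by simp [hy]) (hcl.bar_not_mem hn1 (x := x) (by
        have : x ∈ [C.bar e] := by rw [hx]; simp
        simp only [List.mem_append, List.mem_cons] at this ⊢; tauto))
  have hA : ¬ 2 ≤ A.length := by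
    intro hA
    apply h
    rw [show P ++ e :: (Q ++ (A ++ C.bar e :: B)) = (P ++ e :: Q) ++ (A ++ C.bar e :: B) by simp,
      C.cyc, List.append_assoc, C.cyc,
      show C.bar e :: B ++ (P ++ e :: Q) = [C.bar e] ++ (B ++ (P ++ e :: Q)) by simp,
      C.cut _ _ (by simp; omega) hA, splitSum_append, splitSum_append]
    refine hz _ _ _ ?_ ?_ ?_ <;>
      refine splitSum_eq_zero fun l x r hx => splitSum_eq_zero fun l' y r' hy => ?_ <;>
      split_ifs with hyx <;> try rfl
    all_goals subst hyx
    · exact absurd (by simp [hy]) (hcl.bar_not_mem hn1 (x := x) (by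
        have : x ∈ [C.bar e] := by rw [hx]; simp
        simp only [List.mem_append, List.mem_cons] at this ⊢; tauto))
    · have e1 := C.cyc (x :: (l' ++ r)) (P ++ e :: (Q ++ C.bar x :: C.bar e :: (l ++ r')))
      have e4 := H (C.bar x) (l ++ (r' ++ x :: (l' ++ r))) (by
        intro hxx
        rw [C.bar_bar] at hxx
        have h1 : x ∈ A := by rw [hy, ← hxx]; simp
        have h2 : x ∈ B := by rw [hx]; simp
        exact List.disjoint_of_nodup_append hn1.of_append_right h1 h2)
      simp only [List.cons_append, List.append_assoc, List.nil_append] at e1 e4 ⊢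
      rw [e1, e4]
    · exact absurd (by simp [hy]) (hcl.bar_not_mem hn1 (x := x) (by
        have : x ∈ P ++ e :: Q := by rw [hx]; simp
        simp only [List.mem_append, List.mem_cons] at this ⊢; tauto))
  have hA' : A = [] ∨ ∃ g, C.bar g = g ∧ A = [g] := by
    match A, hA with
    | [], _ => exact Or.inl rfl
    | [a], _ =>
      refine Or.inr ⟨a, ?_, rfl⟩
      by_contra ha
      exact h (H a B ha)
    | _ :: _ :: _, hA => exact absurd (by simp) hA
  refine ⟨hA', ?_⟩
  match B, hB with
  | [], _ => exact Or.inl rfl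
  | [b], _ =>
    refine Or.inr ⟨b, rfl.trans ?_, rfl⟩
    -- The other end of a chord at `b` would have to lie in `A`, which has no room for a chord end.
    by_contra hb
    have hm := C.mem_of_ne _ h (C.bar b)
    have hb' : C.bar b ∉ P ++ e :: (Q ++ [C.bar e]) := fun hx =>
      hcl.bar_not_mem hn1 hx (by simp [C.bar_bar])
    rcases hA' with rfl | ⟨g, hg, rfl⟩
    · simp only [List.mem_append, List.mem_cons, List.not_mem_nil, or_false] at hm hb'
      tauto
    · by_cases hbg : C.bar b = g
      · have : b = g := by rw [← C.bar_bar b, hbg, hg]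
        exact hb (by rw [hbg, this])
      · simp only [List.mem_append, List.mem_cons, List.not_mem_nil, or_false] at hm hb'
        tauto
  | _ :: _ :: _, hB => exact absurd (by simp) hB

/-- Every word with a nest vanishes, if all the free letters that remain outside of it have a
companion inside. -/
theorem val_nest_eq_zero [IsAddTorsionFree M] (hsize : 5 ≤ C.size) {F : List α}
    (hF : (F = [] ∧ ∀ g, C.bar g ≠ g) ∨ ∃ f, C.bar f = f ∧ F = [f]) (m : ℕ) (cs : List (α × α))
    (e : α) (he : C.bar e ≠ e) (R : List α) (hR : R.length = m) :
    C.val (C.nestL [] cs ++ e :: (C.nestR [] cs ++ (F ++ R))) = 0 := by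
  induction m using Nat.strong_induction_on generalizing cs e R with
  | _ m ih =>
  have hFc : C.Closed F := by
    rcases hF with ⟨rfl, -⟩ | ⟨f, hf, rfl⟩
    · exact Closed.nil
    · simp [Closed, hf]
  have hc : C.Closed (C.nestL [] cs ++ (C.nestR [] cs ++ F)) := by
    have := Closed.nest (p₀ := []) (q₀ := F) hFc cs
    have h := C.nestR_append [] F cs
    rw [List.nil_append] at h
    rwa [h] at this
  by_contra h
  set U := C.nestL [] cs with hU
  set V := C.nestR [] cs with hV
  have hn := C.nodup_of_ne _ h
  have heR : C.bar e ∈ R := by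
    have hm := C.mem_of_ne _ h (C.bar e)
    have : C.bar e ∉ U ++ (V ++ F) := fun hm => by
      have h1 := hc _ hm
      rw [C.bar_bar] at h1
      have h2 : ((U ++ (V ++ F)) ++ e :: R).Nodup := by
        refine (List.Perm.nodup_iff ?_).1 hn
        rw [List.perm_iff_count]; intro a; simp [List.count_cons]; omega
      exact List.disjoint_of_nodup_append h2 h1 (by simp)
    simp only [List.mem_append, List.mem_cons] at hm this
    tauto
  obtain ⟨A, B, hAB⟩ := List.append_of_mem heR
  rw [hAB] at h
  -- A chord `t` directly before `ē` can be absorbed with `e` as a new innermost block of the nest.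
  have H : ∀ t R', C.bar t ≠ t → C.val (U ++ e :: ((V ++ F) ++ t :: C.bar e :: R')) = 0 := by
    intro t R' ht
    by_contra h'
    have hc2 : C.Closed ((U ++ e :: (V ++ F)) ++ [C.bar e]) := (hc.chord e).perm (by
      rw [List.perm_iff_count]; intro a; simp [List.count_cons]; omega)
    have hn' := C.nodup_of_ne _ h'
    have htR : C.bar t ∈ R' := by
      have hm := C.mem_of_ne _ h' (C.bar t)
      have : C.bar t ∉ (U ++ e :: (V ++ F)) ++ [C.bar e] := fun hm => by
        have h1 := hc2 _ hm
        rw [C.bar_bar] at h1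
        have h2 : (((U ++ e :: (V ++ F)) ++ [C.bar e]) ++ t :: R').Nodup := by
          refine (List.Perm.nodup_iff ?_).1 hn'
          rw [List.perm_iff_count]; intro a; simp [List.count_cons]; omega
        exact List.disjoint_of_nodup_append h2 h1 (by simp)
      simp only [List.mem_append, List.mem_cons, List.not_mem_nil, or_false] at hm this
      tauto
    obtain ⟨A', B', hAB'⟩ := List.append_of_mem htR
    rw [hAB'] at h'
    -- Up to a nonzero multiple this is a word with the nest enlarged by `(e, t)` and placed at `s`,
    -- whose remainder is shorter, so the induction applies.
    have H2 : ∀ s R'', C.bar s ≠ s → C.val ((U ++ e :: (V ++ F)) ++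
        t :: ([C.bar e] ++ s :: C.bar t :: R'')) = 0 := by
      intro s R'' hs
      by_contra h''
      have k := C.extends_nest_right hFc cs e t [s] R''
      have hl := C.length_of_ne _ h''
      have hl' := C.length_of_ne _ h
      simp only [List.length_append, List.length_cons, List.length_nil] at hl hl'
      have k2 := ih R''.length (by rw [← hR, hAB]; simp; omega) ((e, t) :: cs) s hs R'' rfl
      rw [nestL_cons, nestR_cons, ← hU, ← hV] at k2
      rw [← hU, ← hV] at k
      simp only [List.cons_append, List.append_assoc, List.nil_append] at k k2 h''
      rw [k2] at k
      exact h'' ((smul_eq_zero_iff_right (Nat.succ_ne_zero _)).1 k)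
    have h3 : C.val ((U ++ e :: (V ++ F)) ++ t :: ([C.bar e] ++ (A' ++ C.bar t :: B'))) ≠ 0 := by
      simpa using h'
    obtain ⟨hA', hB'⟩ := C.eq_nil_or_free_of_val_ne_zero hc2 H2 h3
    apply h'
    rcases hF with ⟨rfl, hno⟩ | ⟨f, hf, rfl⟩
    · rcases hA' with rfl | ⟨g, hg, -⟩
      · rcases hB' with rfl | ⟨g, hg, -⟩
        · simpa using C.val_nest_pair hFc cs e t
        · exact absurd hg (hno g)
      · exact absurd hg (hno g)
    · rcases hB' with rfl | ⟨g, hg, rfl⟩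
      · rcases hA' with rfl | ⟨g, hg, rfl⟩
        · simpa using C.val_nest_pair hFc cs e t
        · simpa using C.val_nest_pair_free_left hf hg cs e t
      · simpa using C.val_nest_pair_free_right hf hg cs e t A'
  have h3 : C.val (U ++ e :: ((V ++ F) ++ (A ++ C.bar e :: B))) ≠ 0 := by simpa using h
  obtain ⟨hA, hB⟩ := C.eq_nil_or_free_of_val_ne_zero hc H h3
  have hG : ∀ G, (G = [] ∨ ∃ g, C.bar g = g ∧ G = [g]) → C.Closed G ∧ G.length ≤ 1 := by
    rintro _ (rfl | ⟨g, hg, rfl⟩)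
    · exact ⟨Closed.nil, by simp⟩
    · exact ⟨by simp [Closed, hg], by simp⟩
  rcases hA with rfl | ⟨g, hg, rfl⟩
  · obtain ⟨hB1, hB2⟩ := hG B hB
    -- For the empty nest the whole word is `e F ē B` with at most four letters, which contradicts
    -- the size.
    by_cases hcs : cs = []
    · have hl := C.length_of_ne _ h
      have hF1 : F.length ≤ 1 := (hG F (hF.imp (fun h => h.1) id)).2
      simp [hU, hV, hcs] at hl
      omega
    · exact h (C.val_nest_end hFc hB1 hcs e)
  · rcases hF with ⟨rfl, hno⟩ | ⟨f, hf, rfl⟩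
    · exact hno g hg
    · refine h ?_
      have hl := C.length_of_ne _ h
      have := C.val_free_adjacent hf hg (s := U ++ e :: V) (t := C.bar e :: B) (by
        simp only [List.length_append, List.length_cons, List.length_nil] at hl ⊢; omega)
      simpa using this

theorem exists_chord_free (w : List α) (z : α) (hz : C.bar z ≠ z) (h : ∃ g ∈ w, C.bar g = g) :
    ∃ s t y f, C.bar y ≠ y ∧ C.bar f = f ∧ z :: w = s ++ y :: f :: t := by
  induction w generalizing z with
  | nil => simp at h
  | cons a w ih =>
    by_cases ha : C.bar a = a
    · exact ⟨[], w, z, a, hz, ha, rfl⟩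
    · obtain ⟨s, t, y, f, h1, h2, h3⟩ := ih a ha (by
        obtain ⟨g, hg, hg'⟩ := h
        rcases List.mem_cons.1 hg with rfl | hg
        · exact absurd hg' ha
        · exact ⟨g, hg, hg'⟩)
      exact ⟨z :: s, t, y, f, h1, h2, by rw [h3]; rfl⟩

/-- The induction starts from the empty nest at a chord end, followed by a free letter if there is
one. Without chords, any two adjacent letters form a closed arc. -/
theorem val_eq_zero [IsAddTorsionFree M] (hsize : 5 ≤ C.size) (w : List α) : C.val w = 0 := by
  by_contra h
  have hl := C.length_of_ne _ h
  by_cases hz : ∃ z, C.bar z ≠ z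
  · obtain ⟨z, hz⟩ := hz
    obtain ⟨s, t, rfl⟩ := List.append_of_mem (C.mem_of_ne _ h z)
    rw [C.cyc] at h
    by_cases hf : ∃ g, C.bar g = g
    · obtain ⟨g, hg⟩ := hf
      have hgm : g ∈ t ++ s := by
        have := C.mem_of_ne _ h g
        rw [List.cons_append, List.mem_cons] at this
        exact this.resolve_left (by rintro rfl; exact hz hg)
      obtain ⟨s', t', y, f, h1, h2, h3⟩ := C.exists_chord_free (t ++ s) z hz ⟨g, hgm, hg⟩
      rw [List.cons_append, h3, C.cyc] at h
      exact h (C.val_nest_eq_zero hsize (Or.inr ⟨f, h2, rfl⟩) _ [] y h1 (t' ++ s') rfl)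
    · push Not at hf
      exact h (C.val_nest_eq_zero hsize (Or.inl ⟨rfl, hf⟩) _ [] z hz (t ++ s) rfl)
  · push Not at hz
    rw [← List.take_append_drop 2 w] at h
    refine h (C.val_closed_append (fun x hx => by rwa [hz x]) ?_ ?_)
    · rw [List.length_take]; omega
    · rw [List.length_drop]; omega

end ChordFunctional

/-! ### Cyclic words as symplectic derivations. -/

theorem splitSum_sum {α M ι : Type*} [AddCommMonoid M] (s : Finset ι) (w : List α)
    (F : ι → List α → α → List α → M) :
    ∑ i ∈ s, splitSum w (F i) = splitSum w fun l x r => ∑ i ∈ s, F i l x r := by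
  induction w generalizing F with
  | nil => simp
  | cons a w ih => simp only [splitSum_cons, Finset.sum_add_distrib, ih]

theorem splitSum_length {α M : Type*} [AddCommMonoid M] (w : List α) (H : ℕ → M) :
    splitSum w (fun l _ _ => H l.length) = ∑ j ∈ Finset.range w.length, H j := by
  induction w generalizing H with
  | nil => simp
  | cons a w ih =>
    rw [splitSum_cons, List.length_cons, Finset.sum_range_succ', add_comm, ← ih fun j => H (j + 1)]
    rfl

theorem splitSum_rotate {α M : Type*} [AddCommMonoid M] (w : List α) (G : List α → M) :
    splitSum w (fun l x r => G (r ++ (l ++ [x])))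
      = ∑ j ∈ Finset.range w.length, G (w.rotate (j + 1)) := by
  rw [← splitSum_length w fun j => G (w.rotate (j + 1))]
  refine splitSum_congr fun l x r h => ?_
  have : w = (l ++ [x]) ++ r := by simp [h]
  rw [this, show l.length + 1 = (l ++ [x]).length by simp, List.rotate_append_length_eq]

theorem splitSum_rotate' {α M : Type*} [AddCommMonoid M] (w : List α) (G : List α → M) :
    splitSum w (fun l x r => G (x :: (r ++ l)))
      = ∑ j ∈ Finset.range w.length, G (w.rotate j) := by
  rw [← splitSum_length w fun j => G (w.rotate j)]
  refine splitSum_congr fun l x r h => ?_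
  rw [h, List.rotate_append_length_eq]
  rfl

theorem sum_rotate_succ {α M : Type*} [AddCommMonoid M] (w : List α) (G : List α → M) :
    ∑ j ∈ Finset.range w.length, G (w.rotate (j + 1))
      = ∑ j ∈ Finset.range w.length, G (w.rotate j) := by
  cases h : w.length with
  | zero => simp
  | succ n =>
    rw [Finset.sum_range_succ, Finset.sum_range_succ', ← h, List.rotate_length, List.rotate_zero]

theorem splitSum_smul {α M : Type*} [AddCommGroup M] [Module ℚ M] (c : ℚ) (w : List α)
    (F : List α → α → List α → M) :
    c • splitSum w F = splitSum w fun l x r => c • F l x r :=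
  map_splitSum (DistribSMul.toAddMonoidHom M c) w F

theorem splitSum_neg {α M : Type*} [AddCommGroup M] (w : List α) (F : List α → α → List α → M) :
    (splitSum w fun l x r => - F l x r) = - splitSum w F :=
  (map_splitSum (negAddMonoidHom (α := M)) w F).symm

theorem splitSum_mem {α M : Type*} [AddCommGroup M] [Module ℚ M] {S : Submodule ℚ M} {w : List α}
    {F : List α → α → List α → M} (h : ∀ l x r, w = l ++ x :: r → F l x r ∈ S) :
    splitSum w F ∈ S := by
  induction w generalizing F with
  | nil => exact S.zero_mem
  | cons y w ih =>
    exact S.add_mem (h [] y w rfl) (ih fun l x r e => h (y :: l) x r (by rw [e]; rfl))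

/-- The letters, that is, the basis of `H_ℚ`. -/
abbrev Letter (g : ℕ) : Type := Fin g ⊕ Fin g

variable {g : ℕ}

/-- The symplectic form on the letters. -/
def pairing (x y : Letter g) : ℚ := if y = x.swap then (Sum.elim (fun _ => 1) (fun _ => -1) x) else 0

theorem pairing_swap_self (x : Letter g) :
    pairing x x.swap = Sum.elim (fun _ => 1) (fun _ => -1) x := by simp [pairing]

theorem pairing_of_ne {x y : Letter g} (h : y ≠ x.swap) : pairing x y = 0 := if_neg h

theorem pairing_comm (x y : Letter g) : pairing y x = - pairing x y := by
  unfold pairing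
  by_cases h : y = x.swap
  · subst h
    cases x <;> simp
  · rw [if_neg h, if_neg, neg_zero]
    rintro rfl
    simp at h

theorem pairing_mul_self (x : Letter g) : pairing x x.swap * pairing x x.swap = 1 := by
  rw [pairing_swap_self]
  cases x <;> simp

/-- The word as an element of the free algebra; the empty word is sent to `0`. -/
def word : List (Letter g) → T g
  | [] => 0
  | x :: w => MonoidAlgebra.single ⟨x, w⟩ 1

theorem word_append {u v : List (Letter g)} (hu : u ≠ []) (hv : v ≠ []) :
    word (u ++ v) = word u * word v := by
  obtain ⟨x, u, rfl⟩ := List.exists_cons_of_ne_nil hu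
  obtain ⟨y, v, rfl⟩ := List.exists_cons_of_ne_nil hv
  simp [word, MonoidAlgebra.single_mul_single, FreeSemigroup.mk_mul_mk]

theorem a_eq_word (i : Fin g) : a i = word [Sum.inl i] := rfl

theorem b_eq_word (i : Fin g) : b i = word [Sum.inr i] := rfl

theorem word_mem_tensorPower (w : List (Letter g)) : word w ∈ tensorPower g w.length := by
  cases w with
  | nil => exact Submodule.zero_mem _
  | cons x w => exact Submodule.subset_span ⟨⟨x, w⟩, rfl, rfl⟩

theorem tensorPower_induction {n : ℕ} {p : T g → Prop} {t : T g} (ht : t ∈ tensorPower g n)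
    (hw : ∀ w : List (Letter g), w.length = n → w ≠ [] → p (word w)) (h0 : p 0)
    (hadd : ∀ x y, p x → p y → p (x + y)) (hsmul : ∀ (c : ℚ) x, p x → p (c • x)) : p t := by
  induction ht using Submodule.span_induction with
  | mem x hx =>
    obtain ⟨w, hl, rfl⟩ := hx
    exact hw (w.head :: w.tail) hl (by simp)
  | zero => exact h0
  | add x y _ _ hx hy => exact hadd x y hx hy
  | smul c x _ hx => exact hsmul c x hx

/-- The linear map with given values on the words. -/
def onWords {N : Type*} [AddCommMonoid N] [Module ℚ N] (φ : List (Letter g) → N) : T g →ₗ[ℚ] N :=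
  (Finsupp.linearCombination ℚ fun s : FreeSemigroup (Letter g) => φ (s.head :: s.tail)) ∘ₗ
    (MonoidAlgebra.coeffLinearEquiv ℚ).toLinearMap

theorem onWords_word {N : Type*} [AddCommMonoid N] [Module ℚ N] (φ : List (Letter g) → N)
    (h : φ [] = 0) (w : List (Letter g)) : onWords φ (word w) = φ w := by
  cases w with
  | nil => rw [h]; exact map_zero _
  | cons x w => simp [onWords, word, MonoidAlgebra.coeffLinearEquiv]

theorem linearMap_ext_word {N : Type*} [AddCommMonoid N] [Module ℚ N] {φ ψ : T g →ₗ[ℚ] N}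
    (h : ∀ w, w ≠ [] → φ (word w) = ψ (word w)) : φ = ψ := by
  refine MonoidAlgebra.lhom_ext' fun s => ?_
  ext
  exact h (s.head :: s.tail) (by simp)

theorem isDer_of_word {D : Module.End ℚ (T g)}
    (h : ∀ u v, u ≠ [] → v ≠ [] → D (word u * word v) = D (word u) * word v + word u * D (word v))
    (x y : T g) : D (x * y) = D x * y + x * D y := by
  have h1 : ∀ u, u ≠ [] → D ∘ₗ LinearMap.mulLeft ℚ (word u)
      = LinearMap.mulLeft ℚ (D (word u)) + LinearMap.mulLeft ℚ (word u) ∘ₗ D := fun u hu =>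
    linearMap_ext_word fun v hv => by simpa using h u v hu hv
  have h2 : D ∘ₗ LinearMap.mulRight ℚ y
      = LinearMap.mulRight ℚ y ∘ₗ D + LinearMap.mulRight ℚ (D y) :=
    linearMap_ext_word fun u hu => by simpa using LinearMap.congr_fun (h1 u hu) y
  simpa using LinearMap.congr_fun h2 x

theorem der_ext {D E : Module.End ℚ (T g)} (hD : D ∈ Der g) (hE : E ∈ Der g)
    (h : ∀ z : Letter g, D (word [z]) = E (word [z])) : D = E := by
  have hD' : ∀ x y : T g, D (x * y) = D x * y + x * D y := hD
  have hE' : ∀ x y : T g, E (x * y) = E x * y + x * E y := hE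
  refine linearMap_ext_word fun w hw => ?_
  induction w with
  | nil => exact absurd rfl hw
  | cons z w ih =>
    by_cases h0 : w = []
    · rw [h0, h]
    · rw [show z :: w = [z] ++ w from rfl, word_append (by simp) h0, hD', hE', h, ih h0]

/-- The derivation given by a cyclic word. -/
def cycDer (u : List (Letter g)) : Module.End ℚ (T g) := onWords fun v =>
  splitSum v fun l' s r' => splitSum u fun l x r => pairing s x • word (l' ++ (r ++ (l ++ r')))

theorem cycDer_word (u v : List (Letter g)) : cycDer u (word v) =
    splitSum v fun l' s r' => splitSum u fun l x r =>
      pairing s x • word (l' ++ (r ++ (l ++ r'))) := onWords_word _ rfl v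

theorem cycDer_letter (u : List (Letter g)) (z : Letter g) : cycDer u (word [z]) =
    splitSum u fun l x r => pairing z x • word (r ++ l) := by
  rw [cycDer_word]
  simp

theorem cycDer_mem_Der {u : List (Letter g)} (hu : 2 ≤ u.length) : cycDer u ∈ Der g := by
  refine isDer_of_word fun v v' hv hv' => ?_
  rw [← word_append hv hv', cycDer_word, splitSum_append, cycDer_word, cycDer_word]
  have h1 : ∀ t : T g, splitSum v (fun l' s r' => splitSum u fun l x r =>
      pairing s x • word (l' ++ (r ++ (l ++ r')))) * t = splitSum v fun l' s r' =>
        splitSum u fun l x r => pairing s x • (word (l' ++ (r ++ (l ++ r'))) * t) := by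
    intro t
    refine (map_splitSum (LinearMap.mulRight ℚ t) v _).trans (splitSum_congr fun l' s r' _ =>
      (map_splitSum (LinearMap.mulRight ℚ t) u _).trans (splitSum_congr fun l x r _ => ?_))
    rw [map_smul]
    rfl
  have h2 : ∀ t : T g, t * splitSum v' (fun l' s r' => splitSum u fun l x r =>
      pairing s x • word (l' ++ (r ++ (l ++ r')))) = splitSum v' fun l' s r' =>
        splitSum u fun l x r => pairing s x • (t * word (l' ++ (r ++ (l ++ r')))) := by
    intro t
    refine (map_splitSum (LinearMap.mulLeft ℚ t) v' _).trans (splitSum_congr fun l' s r' _ =>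
      (map_splitSum (LinearMap.mulLeft ℚ t) u _).trans (splitSum_congr fun l x r _ => ?_))
    rw [map_smul]
    rfl
  -- The empty word is sent to `0` rather than to a unit, so `word_append` requires something to
  -- remain of `u` after one letter is removed.
  have hne : ∀ l x r, u = l ++ x :: r → ∀ l' r' : List (Letter g),
      l' ++ (r ++ (l ++ r')) ≠ [] := by
    intro l x r e l' r' h
    simp only [List.append_eq_nil_iff] at h
    rw [e, h.2.1, h.2.2.1] at hu
    simp at hu
  rw [h1, h2]
  congr 1
  · refine splitSum_congr fun l' s r' _ => splitSum_congr fun l x r e => ?_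
    rw [← word_append (hne l x r e _ _) hv']
    simp
  · refine splitSum_congr fun l' s r' _ => splitSum_congr fun l x r e => ?_
    rw [← word_append hv (hne l x r e _ _)]
    simp

theorem sum_pairing {N : Type*} [AddCommGroup N] [Module ℚ N] (x : Letter g) (φ : Letter g → N) :
    ∑ i : Fin g, (pairing (Sum.inl i) x • φ (Sum.inr i) - pairing (Sum.inr i) x • φ (Sum.inl i))
      = φ x := by
  cases x with
  | inl j => simp [pairing, Finset.sum_ite_eq]
  | inr j => simp [pairing, Finset.sum_ite_eq]

/-- Contracting `u` with `ω₀` gives the sum of all rotations of `u` from each side, with opposite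
signs; the two index ranges differ by one full turn's shift. -/
theorem cycDer_omega (u : List (Letter g)) : cycDer u (omega g) = 0 := by
  have h1 : ∀ i : Fin g, cycDer u (a i * b i - b i * a i)
      = splitSum u (fun l x r => pairing (Sum.inl i) x • word (r ++ (l ++ [Sum.inr i]))
          - pairing (Sum.inr i) x • word (r ++ (l ++ [Sum.inl i])))
        + -splitSum u (fun l x r => pairing (Sum.inl i) x • word (Sum.inr i :: (r ++ l))
          - pairing (Sum.inr i) x • word (Sum.inl i :: (r ++ l))) := by
    intro i
    rw [a_eq_word, b_eq_word, ← word_append (by simp) (by simp), ← word_append (by simp) (by simp),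
      map_sub, cycDer_word, cycDer_word]
    have hs : ∀ F G : List (Letter g) → Letter g → List (Letter g) → T g,
        splitSum u (fun l x r => F l x r - G l x r) = splitSum u F - splitSum u G := by
      intro F G
      rw [eq_sub_iff_add_eq, ← splitSum_add]
      simp
    simp only [List.cons_append, List.nil_append, splitSum_cons, splitSum_nil, add_zero, hs,
      List.append_nil]
    abel
  rw [omega, map_sum, Finset.sum_congr rfl fun i _ => h1 i, Finset.sum_add_distrib,
    Finset.sum_neg_distrib, splitSum_sum, splitSum_sum]
  simp only [fun (l r : List (Letter g)) (x : Letter g) =>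
    sum_pairing x fun y => word (r ++ (l ++ [y])), fun (l r : List (Letter g)) (x : Letter g) =>
    sum_pairing x fun y => word (y :: (r ++ l))]
  rw [splitSum_rotate, splitSum_rotate', sum_rotate_succ, add_neg_cancel]

theorem cycDer_mem_symp {u : List (Letter g)} (hu : 2 ≤ u.length) : cycDer u ∈ symp g :=
  ⟨cycDer_mem_Der hu, cycDer_omega u⟩

theorem cycDer_mem_sympDeg {u : List (Letter g)} {k : ℕ} (hu : u.length = k + 2) :
    (⟨cycDer u, cycDer_mem_symp (by omega)⟩ : symp g) ∈ sympDeg g k := by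
  intro t ht
  change cycDer u t ∈ _
  refine tensorPower_induction (p := fun t => cycDer u t ∈ tensorPower g (k + 1)) ht ?_ ?_ ?_ ?_
  · intro w hw _
    obtain ⟨z, rfl⟩ := List.length_eq_one_iff.1 hw
    rw [cycDer_letter]
    refine splitSum_mem fun l x r h => Submodule.smul_mem _ _ ?_
    have hl : (r ++ l).length = k + 1 := by
      rw [h] at hu
      simp at hu ⊢; omega
    rw [← hl]
    exact word_mem_tensorPower _
  · rw [map_zero]; exact Submodule.zero_mem _
  · intro x y hx hy; rw [map_add]; exact Submodule.add_mem _ hx hy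
  · intro c x hx; rw [map_smul]; exact Submodule.smul_mem _ c hx

theorem cycDer_append_comm (u v : List (Letter g)) (hu : 2 ≤ (u ++ v).length) :
    cycDer (u ++ v) = cycDer (v ++ u) := by
  refine der_ext (cycDer_mem_Der hu) (cycDer_mem_Der (by simp at hu ⊢; omega)) fun z => ?_
  rw [cycDer_letter, cycDer_letter, splitSum_append, splitSum_append, add_comm]
  simp only [List.append_assoc]

/-- The bracket of two cyclic words. -/
theorem lie_cycDer {u v : List (Letter g)} (hu : 2 ≤ u.length) (hv : 2 ≤ v.length) :
    ⁅cycDer u, cycDer v⁆ = splitSum v fun l' s r' => splitSum u fun l x r =>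
      pairing s x • cycDer (r ++ (l ++ (r' ++ l'))) := by
  have hmem : (splitSum v fun l' s r' => splitSum u fun l x r =>
      pairing s x • cycDer (r ++ (l ++ (r' ++ l')))) ∈ Der g := by
    refine splitSum_mem (S := (Der g).toSubmodule) fun l' s r' hv' => splitSum_mem
      fun l x r hu' => Submodule.smul_mem _ _ (cycDer_mem_Der ?_)
    rw [hu'] at hu
    rw [hv'] at hv
    simp at hu hv ⊢
    omega
  refine der_ext ((Der g).lie_mem (cycDer_mem_Der hu) (cycDer_mem_Der hv)) hmem fun z => ?_
  -- After `v` is opened at `y`, the letter replaced by `u` lies either in `r'` or in `l'`.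
  have hA : ∀ u v : List (Letter g), cycDer u (cycDer v (word [z]))
      = (splitSum v fun l' y r' => splitSum r' fun m s m' => splitSum u fun l x r =>
          pairing z y • pairing s x • word (m ++ (r ++ (l ++ (m' ++ l')))))
        + splitSum v fun l' y r' => splitSum l' fun m s m' => splitSum u fun l x r =>
          pairing z y • pairing s x • word (r' ++ (m ++ (r ++ (l ++ m')))) := by
    intro u v
    rw [cycDer_letter, map_splitSum, ← splitSum_add]
    refine splitSum_congr fun l' y r' _ => ?_
    rw [map_smul, cycDer_word, splitSum_append]
    simp only [smul_add, splitSum_smul, List.append_assoc]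
  -- The letter `y` paired with `z` lies in one of the four remainders. If it comes from `u`,
  -- antisymmetry of the pairing gives the minus sign of the second composite. The terms with both
  -- contractions in the same word cancel after the order of choice is exchanged.
  have hB : (splitSum v fun l' s r' => splitSum u fun l x r =>
      pairing s x • cycDer (r ++ (l ++ (r' ++ l')))) (word [z])
      = ((splitSum v fun l' s r' => splitSum l' fun m y m' => splitSum u fun l x r =>
          pairing z y • pairing s x • word (m' ++ (r ++ (l ++ (r' ++ m)))))
        + (splitSum v fun l' s r' => splitSum r' fun m y m' => splitSum u fun l x r =>
          pairing z y • pairing s x • word (m' ++ (l' ++ (r ++ (l ++ m))))))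
        - ((splitSum u fun l x r => splitSum l fun m y m' => splitSum v fun l' s r' =>
          pairing z y • pairing x s • word (m' ++ (r' ++ (l' ++ (r ++ m)))))
        + (splitSum u fun l x r => splitSum r fun m y m' => splitSum v fun l' s r' =>
          pairing z y • pairing x s • word (m' ++ (l ++ (r' ++ (l' ++ m)))))) := by
    have h1 := map_splitSum (LinearMap.applyₗ (R := ℚ) (M₂ := T g) (word [z])) v fun l' s r' =>
      splitSum u fun l x r => pairing s x • cycDer (r ++ (l ++ (r' ++ l')))
    refine h1.trans ?_
    have h2 : ∀ (l' : List (Letter g)) (s : Letter g) (r' l : List (Letter g)) (x : Letter g)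
        (r : List (Letter g)), pairing s x • cycDer (r ++ (l ++ (r' ++ l'))) (word [z])
        = (splitSum r fun m y m' =>
            -(pairing z y • pairing x s • word (m' ++ (l ++ (r' ++ (l' ++ m))))))
        + ((splitSum l fun m y m' =>
            -(pairing z y • pairing x s • word (m' ++ (r' ++ (l' ++ (r ++ m))))))
        + ((splitSum r' fun m y m' =>
            pairing z y • pairing s x • word (m' ++ (l' ++ (r ++ (l ++ m)))))
        + splitSum l' fun m y m' =>
            pairing z y • pairing s x • word (m' ++ (r ++ (l ++ (r' ++ m)))))) := by
      intro l' s r' l x r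
      rw [cycDer_letter, splitSum_append, splitSum_append, splitSum_append]
      simp only [smul_add, splitSum_smul, smul_comm (pairing s x), List.append_assoc]
      simp only [pairing_comm x s, neg_smul, smul_neg]
    simp only [map_splitSum, map_smul, LinearMap.applyₗ_apply_apply, h2, splitSum_add,
      splitSum_neg]
    rw [splitSum_comm v u fun l' s r' l x r => splitSum r fun m y m' =>
        pairing z y • pairing x s • word (m' ++ (l ++ (r' ++ (l' ++ m)))),
      splitSum_comm v u fun l' s r' l x r => splitSum l fun m y m' =>
        pairing z y • pairing x s • word (m' ++ (r' ++ (l' ++ (r ++ m))))]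
    simp only [fun (l r : List (Letter g)) (x : Letter g) => splitSum_comm v r
      fun l' s r' m y m' => pairing z y • pairing x s • word (m' ++ (l ++ (r' ++ (l' ++ m)))),
      fun (l r : List (Letter g)) (x : Letter g) => splitSum_comm v l
      fun l' s r' m y m' => pairing z y • pairing x s • word (m' ++ (r' ++ (l' ++ (r ++ m)))),
      fun (l' r' : List (Letter g)) (s : Letter g) => splitSum_comm u r'
      fun l x r m y m' => pairing z y • pairing s x • word (m' ++ (l' ++ (r ++ (l ++ m)))),
      fun (l' r' : List (Letter g)) (s : Letter g) => splitSum_comm u l'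
      fun l x r m y m' => pairing z y • pairing s x • word (m' ++ (r ++ (l ++ (r' ++ m))))]
    abel
  rw [hB]
  change cycDer u (cycDer v (word [z])) - cycDer v (cycDer u (word [z])) = _
  rw [hA, hA]
  have e1 := splitSum_splitSum v fun m y m' s r' => splitSum u fun l x r =>
    pairing z y • pairing s x • word (m' ++ (r ++ (l ++ (r' ++ m))))
  have e2 := splitSum_splitSum v fun l' s m y m' => splitSum u fun l x r =>
    pairing z y • pairing s x • word (m' ++ (l' ++ (r ++ (l ++ m))))
  have e3 := splitSum_splitSum u fun m y m' x r => splitSum v fun l' s r' =>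
    pairing z y • pairing x s • word (m' ++ (r' ++ (l' ++ (r ++ m))))
  have e4 := splitSum_splitSum u fun l x m y m' => splitSum v fun l' s r' =>
    pairing z y • pairing x s • word (m' ++ (l ++ (r' ++ (l' ++ m))))
  rw [e1, e3, ← e2, ← e4]

/-- The cyclic rotation of words. -/
def rot : Module.End ℚ (T g) := onWords fun w => word (w.rotate 1)

theorem rot_word (w : List (Letter g)) : rot (word w) = word (w.rotate 1) := onWords_word _ rfl w

theorem rot_pow_word (w : List (Letter g)) (j : ℕ) :
    (rot ^ j) (word w) = word (w.rotate j) := by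
  induction j with
  | zero => simp
  | succ j ih => rw [pow_succ', Module.End.mul_apply, ih, rot_word, List.rotate_rotate]

theorem rot_letter_mul (z : Letter g) (x : T g) : rot (word [z] * x) = x * word [z] := by
  have : rot ∘ₗ LinearMap.mulLeft ℚ (word [z]) = LinearMap.mulRight ℚ (word [z]) :=
    linearMap_ext_word fun w hw => by
      simp only [LinearMap.comp_apply, LinearMap.mulLeft_apply, LinearMap.mulRight_apply]
      rw [← word_append (by simp) hw, ← word_append hw (by simp), rot_word]
      simp
  exact LinearMap.congr_fun this x

/-- The contraction of the last letter of a word with a given letter. -/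
def contr (z : Letter g) : T g →ₗ[ℚ] T g := onWords fun w =>
  w.getLast?.elim 0 fun y => pairing z y • word w.dropLast

theorem contr_word (z : Letter g) (w : List (Letter g)) (y : Letter g) :
    contr z (word (w ++ [y])) = pairing z y • word w := by
  rw [contr, onWords_word _ rfl]
  simp

theorem contr_mul_letter (z y : Letter g) (x : T g) :
    contr z (x * word [y]) = pairing z y • x := by
  have : contr z ∘ₗ LinearMap.mulRight ℚ (word [y]) = pairing z y • LinearMap.id :=
    linearMap_ext_word fun w hw => by
      simp only [LinearMap.comp_apply, LinearMap.mulRight_apply]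
      rw [← word_append hw (by simp), contr_word]
      rfl
  exact LinearMap.congr_fun this x

theorem cycDer_nil : cycDer ([] : List (Letter g)) = 0 :=
  linearMap_ext_word fun w _ => by
    rw [cycDer_word]
    exact splitSum_eq_zero fun _ _ _ _ => rfl

/-- The derivations of a given degree are combinations of those given by cyclic words. -/
theorem coe_mem_of_cycDer_mem {k : ℕ} {S : Submodule ℚ (Module.End ℚ (T g))}
    (hS : ∀ u : List (Letter g), u.length = k + 2 → cycDer u ∈ S) {D : symp g}
    (hD : D ∈ sympDeg g k) : (D : Module.End ℚ (T g)) ∈ S := by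
  obtain ⟨D, hDer, hω⟩ := D
  change D ∈ S
  have hl : ∀ z : Letter g, D (word [z]) ∈ tensorPower g (k + 1) :=
    fun z => hD _ (word_mem_tensorPower [z])
  have hDm : ∀ x y : T g, D (x * y) = D x * y + x * D y := hDer
  -- The tensor corresponding to `D` under the symplectic form: `D(ω₀) = 0` says exactly that it is
  -- fixed by rotation, and contraction of the last letter recovers `D`.
  set t : T g := ∑ i : Fin g, (D (a i) * b i - D (b i) * a i) with ht
  have hmem : t ∈ tensorPower g (k + 2) := Submodule.sum_mem _ fun i _ =>
    Submodule.sub_mem _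
      (mul_mem_tensorPower (m := k + 1) (n := 1) (hl (Sum.inl i)) (word_mem_tensorPower [Sum.inr i]))
      (mul_mem_tensorPower (m := k + 1) (n := 1) (hl (Sum.inr i)) (word_mem_tensorPower [Sum.inl i]))
  have hrot : rot t = t := by
    have h1 : t = ∑ i : Fin g, (b i * D (a i) - a i * D (b i)) := by
      rw [← sub_eq_zero, ← hω, omega, map_sum, ht, ← Finset.sum_sub_distrib]
      refine Finset.sum_congr rfl fun i _ => ?_
      rw [map_sub, hDm, hDm]
      abel
    conv_lhs => rw [h1]
    rw [map_sum, ht]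
    refine Finset.sum_congr rfl fun i _ => ?_
    rw [map_sub, a_eq_word, b_eq_word, rot_letter_mul, rot_letter_mul]
  have hcontr : ∀ z : Letter g, contr z t = D (word [z]) := by
    intro z
    rw [ht, map_sum]
    simp only [map_sub, a_eq_word, b_eq_word, contr_mul_letter]
    cases z <;> simp [pairing]
  have hΦ : ∀ x ∈ tensorPower g (k + 2), onWords cycDer x ∈ S ∧ onWords cycDer x ∈ Der g ∧
      ∀ z, onWords cycDer x (word [z])
        = ∑ j ∈ Finset.range (k + 2), contr z ((rot ^ (j + 1)) x) := by
    intro x hx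
    refine tensorPower_induction (p := fun x => onWords cycDer x ∈ S ∧ onWords cycDer x ∈ Der g ∧
      ∀ z, onWords cycDer x (word [z])
        = ∑ j ∈ Finset.range (k + 2), contr z ((rot ^ (j + 1)) x)) hx ?_ ?_ ?_ ?_
    · intro w hw _
      rw [onWords_word _ cycDer_nil]
      refine ⟨hS w hw, cycDer_mem_Der (by omega), fun z => ?_⟩
      have := splitSum_rotate w fun v => contr z (word v)
      simp only [← List.append_assoc, contr_word, hw] at this
      rw [cycDer_letter, this]
      simp only [rot_pow_word]
    · simp only [map_zero, LinearMap.zero_apply, Finset.sum_const_zero]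
      exact ⟨S.zero_mem, (Der g).zero_mem, fun _ => trivial⟩
    · rintro x y ⟨h1, h2, h3⟩ ⟨h1', h2', h3'⟩
      rw [map_add]
      refine ⟨S.add_mem h1 h1', (Der g).add_mem h2 h2', fun z => ?_⟩
      rw [LinearMap.add_apply, h3, h3', ← Finset.sum_add_distrib]
      simp only [map_add]
    · rintro c x ⟨h1, h2, h3⟩
      rw [map_smul]
      refine ⟨S.smul_mem c h1, (Der g).smul_mem c h2, fun z => ?_⟩
      rw [LinearMap.smul_apply, h3, Finset.smul_sum]
      simp only [map_smul]
  obtain ⟨h1, h2, h3⟩ := hΦ t hmem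
  -- Each of the `k + 2` rotations of `t` contributes one copy of `D`.
  have h4 : onWords cycDer t = ((k + 2 : ℕ) : ℚ) • D := by
    refine der_ext h2 ((Der g).smul_mem _ hDer) fun z => ?_
    rw [h3]
    have : ∀ j, (rot ^ j) t = t := fun j => by
      rw [Module.End.pow_apply]; exact Function.iterate_fixed hrot j
    simp only [this, hcontr]
    rw [Finset.sum_const, Finset.card_range, LinearMap.smul_apply, Nat.cast_smul_eq_nsmul]
  have h5 := S.smul_mem ((k + 2 : ℕ) : ℚ)⁻¹ h1
  rwa [h4, smul_smul, inv_mul_cancel₀ (by positivity), one_smul] at h5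

/-! ### Classes of cyclic words modulo brackets, and renaming of indices. -/

/-- The span of the brackets of total degree `k`, as a space of endomorphisms. -/
def bracketEnds (g k : ℕ) : Submodule ℚ (Module.End ℚ (T g)) :=
  (brackets g k).map (symp g).toSubmodule.subtype

theorem lie_mem_bracketEnds {i j k : ℕ} (hi : 1 ≤ i) (hj : 1 ≤ j) (hij : i + j = k)
    {D E : symp g} (hD : D ∈ sympDeg g i) (hE : E ∈ sympDeg g j) :
    ⁅(D : Module.End ℚ (T g)), (E : Module.End ℚ (T g))⁆ ∈ bracketEnds g k :=
  ⟨⁅D, E⁆, Submodule.subset_span ⟨i, j, hi, hj, hij, D, E, hD, hE, rfl⟩, rfl⟩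

/-- Derivations of degree `0` preserve the span of the brackets. -/
theorem lie_zero_mem_bracketEnds {k : ℕ} {X : symp g} (hX : X ∈ sympDeg g 0)
    {D : Module.End ℚ (T g)} (hD : D ∈ bracketEnds g k) :
    ⁅(X : Module.End ℚ (T g)), D⁆ ∈ bracketEnds g k := by
  obtain ⟨D, hD, rfl⟩ := hD
  refine ⟨⁅X, D⁆, ?_, rfl⟩
  change D ∈ brackets g k at hD
  change ⁅X, D⁆ ∈ brackets g k
  induction hD using Submodule.span_induction with
  | mem D hD =>
    obtain ⟨i, j, hi, hj, hij, D, E, hD, hE, rfl⟩ := hD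
    rw [leibniz_lie]
    have h1 := lie_mem_sympDeg hX hD
    have h2 := lie_mem_sympDeg hX hE
    rw [zero_add] at h1 h2
    exact Submodule.add_mem _ (Submodule.subset_span ⟨i, j, hi, hj, hij, _, _, h1, hE, rfl⟩)
      (Submodule.subset_span ⟨i, j, hi, hj, hij, _, _, hD, h2, rfl⟩)
  | zero => rw [lie_zero]; exact Submodule.zero_mem _
  | add D E _ _ hD hE => rw [lie_add]; exact Submodule.add_mem _ hD hE
  | smul c D _ hD => rw [lie_smul]; exact Submodule.smul_mem _ c hD

/-- The class of a cyclic word modulo brackets of total degree `k`. -/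
def cls (k : ℕ) (w : List (Letter g)) : Module.End ℚ (T g) ⧸ bracketEnds g k :=
  (bracketEnds g k).mkQ (cycDer w)

theorem cls_append_comm (k : ℕ) (u v : List (Letter g)) (h : 2 ≤ (u ++ v).length) :
    cls k (u ++ v) = cls k (v ++ u) := by
  rw [cls, cycDer_append_comm u v h, cls]

theorem mkQ_lie_cycDer (k : ℕ) {u v : List (Letter g)} (hu : 2 ≤ u.length) (hv : 2 ≤ v.length) :
    (bracketEnds g k).mkQ ⁅cycDer u, cycDer v⁆ = splitSum v fun l' s r' => splitSum u fun l x r =>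
      pairing s x • cls k (r ++ (l ++ (r' ++ l'))) := by
  rw [lie_cycDer hu hv, map_splitSum]
  simp only [map_splitSum, map_smul]
  rfl

theorem splitSum_pairing_of_not_mem {M : Type*} [AddCommGroup M] [Module ℚ M]
    {w : List (Letter g)} {x : Letter g} (h : x.swap ∉ w)
    (G : List (Letter g) → Letter g → List (Letter g) → M) :
    splitSum w (fun l s r => pairing s x • G l s r) = 0 :=
  splitSum_eq_zero fun l s r e => by
    rw [pairing_of_ne, zero_smul]
    rintro rfl
    exact h (by simp [e])

/-- Renaming a pair of letters. -/
theorem cls_rename {k : ℕ} {x y : Letter g} {B C : List (Letter g)}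
    (hk : B.length + C.length = k) (hxy : y ≠ x) (hxy' : y ≠ x.swap)
    (hx : x ∉ B ++ C) (hy' : y.swap ∉ B ++ C)
    (h0 : cls k (x :: (B ++ y.swap :: C)) = 0) :
    cls k (y :: (B ++ y.swap :: C))
      = (pairing x x.swap * pairing y y.swap) • cls k (x :: (B ++ x.swap :: C)) := by
  have hyx' : y.swap ≠ x.swap := fun h => hxy (by simpa using congrArg Sum.swap h)
  -- Up to signs this degree `0` derivation sends `x` to `y` and `y.swap` to `x.swap`. Applied to `x
  -- B y.swap C`, whose class vanishes, it relates the two words of the claim.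
  have hX := cycDer_mem_sympDeg (k := 0) (u := [x.swap, y]) rfl
  have h1 : cycDer (x :: (B ++ y.swap :: C)) ∈ bracketEnds g k := by
    rwa [cls, Submodule.mkQ_apply, Submodule.Quotient.mk_eq_zero] at h0
  have h2 := lie_zero_mem_bracketEnds hX h1
  rw [← Submodule.Quotient.mk_eq_zero, ← Submodule.mkQ_apply] at h2
  simp only [List.mem_append, not_or] at hx hy'
  have h3 := mkQ_lie_cycDer k (u := [x.swap, y]) (v := x :: (B ++ y.swap :: C)) le_rfl
    (by simp; omega)
  have h2' : (bracketEnds g k).mkQ ⁅cycDer [x.swap, y], cycDer (x :: (B ++ y.swap :: C))⁆ = 0 := h2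
  rw [h2'] at h3
  simp only [splitSum_cons, splitSum_nil, splitSum_append, splitSum_add, add_zero,
    List.nil_append, List.append_nil] at h3
  rw [pairing_of_ne hxy', pairing_of_ne (x := y.swap) (y := x.swap) (by simpa using hxy'.symm),
    splitSum_pairing_of_not_mem (by simpa using hx.1),
    splitSum_pairing_of_not_mem (by simpa using hx.2),
    splitSum_pairing_of_not_mem hy'.1, splitSum_pairing_of_not_mem hy'.2] at h3
  simp only [zero_smul, zero_add, add_zero, List.cons_append, List.nil_append] at h3
  have h4 := cls_append_comm k (x.swap :: C) (x :: B) (by simp; omega)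
  simp only [List.cons_append] at h4
  rw [h4, pairing_comm y, neg_smul, eq_comm, add_neg_eq_zero] at h3
  rw [mul_smul, ← h3, smul_smul, pairing_mul_self, one_smul]

/-- The index of a letter. -/
def idx : Letter g → Fin g := Sum.elim id id

theorem idx_eq_iff {x y : Letter g} : idx x = idx y ↔ x = y ∨ x = y.swap := by
  cases x <;> cases y <;> simp [idx]

/-- The set of the indices in a word. -/
def idxSet (w : List (Letter g)) : Finset (Fin g) := (w.map idx).toFinset

theorem idx_mem_idxSet {w : List (Letter g)} {x : Letter g} :
    idx x ∈ idxSet w ↔ x ∈ w ∨ x.swap ∈ w := by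
  simp only [idxSet, List.mem_toFinset, List.mem_map, idx_eq_iff]
  aesop

theorem mem_idxSet {w : List (Letter g)} {i : Fin g} : i ∈ idxSet w ↔ ∃ x ∈ w, idx x = i := by
  simp [idxSet]

theorem idxSet_perm {u v : List (Letter g)} (h : u.Perm v) : idxSet u = idxSet v := by
  ext i
  simp only [mem_idxSet, h.mem_iff]

/-- The words of the same length with more indices have trivial class. -/
def TrivialAbove (k : ℕ) (w : List (Letter g)) : Prop :=
  ∀ w' : List (Letter g), w'.length = k + 2 → (idxSet w).card < (idxSet w').card → cls k w' = 0

theorem TrivialAbove.of_ssubset {k : ℕ} {w w' : List (Letter g)} (h : TrivialAbove k w)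
    (hl : w'.length = k + 2) {z : Letter g} (hz : z ∉ w) (hz' : z.swap ∉ w)
    (hs : ∀ x ∈ z :: w, ∃ y ∈ w', idx y = idx x) : cls k w' = 0 := by
  refine h w' hl (Finset.card_lt_card (Finset.ssubset_iff.2 ⟨idx z, ?_, ?_⟩))
  · rw [idx_mem_idxSet]; tauto
  · intro i hi
    rw [Finset.mem_insert] at hi
    rcases hi with rfl | hi
    · exact mem_idxSet.2 (hs z (by simp))
    · obtain ⟨x, hx, rfl⟩ := mem_idxSet.1 hi
      exact mem_idxSet.2 (hs x (by simp [hx]))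

/-- The permutation of the letters that exchanges the indices of two letters. -/
def ren (x y : Letter g) : Equiv.Perm (Letter g) :=
  Equiv.swap x y * Equiv.swap x.swap y.swap

theorem ren_left {x y : Letter g} (h : y ≠ x) (h' : y ≠ x.swap) : ren x y x = y := by
  have h1 : x ≠ y.swap := by rintro rfl; simp at h'
  have h3 : x ≠ x.swap := by cases x <;> simp
  simp [ren, Equiv.swap_apply_of_ne_of_ne h3 h1]

theorem ren_right {x y : Letter g} (h : y ≠ x) (h' : y ≠ x.swap) : ren x y y = x := by
  have h4 : y ≠ y.swap := by cases y <;> simp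
  simp [ren, Equiv.swap_apply_of_ne_of_ne h' h4]

theorem ren_left_swap {x y : Letter g} (h : y ≠ x) (h' : y ≠ x.swap) :
    ren x y x.swap = y.swap := by
  have h1 : y.swap ≠ x := by rintro rfl; simp at h'
  have h4 : y.swap ≠ y := by cases y <;> simp
  simp [ren, Equiv.swap_apply_of_ne_of_ne h1 h4]

theorem ren_right_swap {x y : Letter g} (h : y ≠ x) (h' : y ≠ x.swap) :
    ren x y y.swap = x.swap := by
  have h1 : x.swap ≠ x := by cases x <;> simp
  simp [ren, Equiv.swap_apply_of_ne_of_ne h1 h'.symm]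

theorem ren_of_ne {x y c : Letter g} (h1 : c ≠ x) (h2 : c ≠ x.swap) (h3 : c ≠ y)
    (h4 : c ≠ y.swap) : ren x y c = c := by
  simp [ren, Equiv.swap_apply_of_ne_of_ne h2 h4, Equiv.swap_apply_of_ne_of_ne h1 h3]

theorem map_ren_of_not_mem {x y : Letter g} {w : List (Letter g)} (h1 : x ∉ w) (h2 : x.swap ∉ w)
    (h3 : y ∉ w) (h4 : y.swap ∉ w) : w.map (ren x y) = w := by
  conv_rhs => rw [← List.map_id w]
  refine List.map_congr_left fun c hc => ?_
  rw [ren_of_ne] <;> first | rfl | (rintro rfl; contradiction)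

/-- The letter and its partner occur in the word, both only once. -/
def Isolated (x : Letter g) (w : List (Letter g)) : Prop :=
  ∃ r : List (Letter g), w.Perm (x :: x.swap :: r) ∧ x ∉ r ∧ x.swap ∉ r

theorem letter_swap_ne (x : Letter g) : x.swap ≠ x := by cases x <;> simp

theorem Isolated.swap {x : Letter g} {w : List (Letter g)} (h : Isolated x w) :
    Isolated x.swap w := by
  obtain ⟨r, h1, h2, h3⟩ := h
  exact ⟨r, by rw [Sum.swap_swap]; exact h1.trans (List.Perm.swap _ _ _), h3, by simpa using h2⟩

theorem Isolated.perm {x : Letter g} {w w' : List (Letter g)} (h : Isolated x w)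
    (hp : w'.Perm w) : Isolated x w' := by
  obtain ⟨r, h1, h2, h3⟩ := h
  exact ⟨r, hp.trans h1, h2, h3⟩

theorem Isolated.mem {x : Letter g} {w : List (Letter g)} (h : Isolated x w) : x ∈ w := by
  obtain ⟨r, h1, -, -⟩ := h
  exact h1.mem_iff.2 (by simp)

/-- Renaming an isolated letter. -/
theorem cls_map_ren {k : ℕ} {w : List (Letter g)} (hw : w.length = k + 2) {x y : Letter g}
    (hx : Isolated x w) (hy : y ∉ w) (hy' : y.swap ∉ w)
    (h : TrivialAbove k w) :
    cls k (w.map (ren x y)) = (pairing x x.swap * pairing y y.swap) • cls k w := by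
  have hxm : x ∈ w := hx.mem
  have hxm' : x.swap ∈ w := hx.swap.mem
  have hxy : y ≠ x := by rintro rfl; exact hy hxm
  have hxy' : y ≠ x.swap := by rintro rfl; exact hy hxm'
  obtain ⟨A, R, rfl⟩ := List.append_of_mem hxm
  have hm : x.swap ∈ R ++ A := by
    simp only [List.mem_append, List.mem_cons, letter_swap_ne, false_or] at hxm' ⊢
    tauto
  obtain ⟨B, C, hBC⟩ := List.append_of_mem hm
  have hp : (A ++ x :: R).Perm (x :: x.swap :: (B ++ C)) :=
    List.perm_middle.trans (List.Perm.cons x (List.perm_append_comm.trans (by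
      rw [hBC]; exact List.perm_middle)))
  obtain ⟨r, hr, hr1, hr2⟩ := hx
  have hBCr : (B ++ C).Perm r := ((hp.symm.trans hr).cons_inv).cons_inv
  have m1 : x ∉ B ++ C := fun h => hr1 (hBCr.mem_iff.1 h)
  have m2 : x.swap ∉ B ++ C := fun h => hr2 (hBCr.mem_iff.1 h)
  have hsub : ∀ c ∈ B ++ C, c ∈ A ++ x :: R := fun c hc => hp.mem_iff.2 (by
    rw [List.mem_cons, List.mem_cons]; tauto)
  have m3 : y ∉ B ++ C := fun hc => hy (hsub _ hc)
  have m4 : y.swap ∉ B ++ C := fun hc => hy' (hsub _ hc)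
  have hl : B.length + C.length = k := by
    have := hp.length_eq
    rw [hw] at this
    simp at this; omega
  rw [cls_append_comm k A (x :: R) (by omega), List.map_append, cls_append_comm, ← List.map_append]
  swap
  · rw [← List.map_append, List.length_map]; omega
  rw [List.cons_append, hBC, List.map_cons, List.map_append, List.map_cons, ren_left hxy hxy',
    ren_left_swap hxy hxy']
  simp only [List.mem_append, not_or] at m1 m2 m3 m4
  rw [map_ren_of_not_mem m1.1 m2.1 m3.1 m4.1, map_ren_of_not_mem m1.2 m2.2 m3.2 m4.2]
  refine cls_rename hl hxy hxy' (by simp [m1]) (by simp [m4]) ?_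
  -- The intermediate word keeps one letter of each pair, so it has all the old indices and that of
  -- `y` as well.
  refine h.of_ssubset (z := y) (by simp; omega) hy hy' fun c hc => ?_
  rcases List.mem_cons.1 hc with rfl | hc
  · exact ⟨c.swap, by simp, idx_eq_iff.2 (Or.inr rfl)⟩
  · rw [hp.mem_iff, List.mem_cons, List.mem_cons, List.mem_append] at hc
    rcases hc with rfl | rfl | hc
    · exact ⟨c, by simp, rfl⟩
    · exact ⟨x, by simp, idx_eq_iff.2 (Or.inr (by simp))⟩
    · exact ⟨c, by simp; tauto, rfl⟩

theorem idxSet_map_ren (x y : Letter g) (hxy : y ≠ x) (hxy' : y ≠ x.swap) (w : List (Letter g)) :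
    (idxSet (w.map (ren x y))).card = (idxSet w).card := by
  have : idxSet (w.map (ren x y)) = (idxSet w).map (Equiv.swap (idx x) (idx y)).toEmbedding := by
    have key : ∀ c, idx (ren x y c) = Equiv.swap (idx x) (idx y) (idx c) := by
      intro c
      have hs : ∀ d : Letter g, idx d.swap = idx d := fun d => idx_eq_iff.2 (Or.inr rfl)
      by_cases h1 : c = x
      · rw [h1, ren_left hxy hxy', Equiv.swap_apply_left]
      by_cases h2 : c = x.swap
      · rw [h2, ren_left_swap hxy hxy', hs, hs, Equiv.swap_apply_left]
      by_cases h3 : c = y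
      · rw [h3, ren_right hxy hxy', Equiv.swap_apply_right]
      by_cases h4 : c = y.swap
      · rw [h4, ren_right_swap hxy hxy', hs, hs, Equiv.swap_apply_right]
      rw [ren_of_ne h1 h2 h3 h4, Equiv.swap_apply_of_ne_of_ne]
      · rw [Ne, idx_eq_iff]; tauto
      · rw [Ne, idx_eq_iff]; tauto
    ext i
    simp only [mem_idxSet, List.mem_map, Finset.mem_map, Equiv.coe_toEmbedding]
    constructor
    · rintro ⟨_, ⟨c, hc, rfl⟩, rfl⟩
      exact ⟨idx c, ⟨c, hc, rfl⟩, (key c).symm⟩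
    · rintro ⟨_, ⟨c, hc, rfl⟩, rfl⟩
      exact ⟨_, ⟨c, hc, rfl⟩, key c⟩
  rw [this, Finset.card_map]

theorem TrivialAbove.map_ren {k : ℕ} {w : List (Letter g)} (h : TrivialAbove k w) {x y : Letter g}
    (hxy : y ≠ x) (hxy' : y ≠ x.swap) : TrivialAbove k (w.map (ren x y)) := by
  intro w' hl hc
  rw [idxSet_map_ren x y hxy hxy'] at hc
  exact h w' hl hc

theorem Isolated.map_ren {x y c : Letter g} {w : List (Letter g)} (h : Isolated c w)
    (hs : ren x y c.swap = (ren x y c).swap) : Isolated (ren x y c) (w.map (ren x y)) := by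
  obtain ⟨r, h1, h2, h3⟩ := h
  refine ⟨r.map (ren x y), ?_, ?_, ?_⟩
  · have := h1.map (ren x y)
    rwa [List.map_cons, List.map_cons, hs] at this
  · rwa [List.mem_map_of_injective (ren x y).injective]
  · rwa [← hs, List.mem_map_of_injective (ren x y).injective]

theorem not_mem_map_ren {x z : Letter g} {w : List (Letter g)} (hz : z ∉ w) (hz' : z.swap ∉ w)
    (h : z ≠ x) (h' : z ≠ x.swap) : x ∉ w.map (ren x z) ∧ x.swap ∉ w.map (ren x z) := by
  refine ⟨fun hm => ?_, fun hm => ?_⟩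
  · obtain ⟨c, hc, e⟩ := List.mem_map.1 hm
    exact hz ((ren x z).injective (e.trans (ren_right h h').symm) ▸ hc)
  · obtain ⟨c, hc, e⟩ := List.mem_map.1 hm
    exact hz' ((ren x z).injective (e.trans (ren_right_swap h h').symm) ▸ hc)

theorem Isolated.map_ren_left {x z : Letter g} {w : List (Letter g)} (hx : Isolated x w)
    (h : z ≠ x) (h' : z ≠ x.swap) : Isolated z (w.map (ren x z)) := by
  have := hx.map_ren (x := x) (y := z) (by rw [ren_left h h', ren_left_swap h h'])
  rwa [ren_left h h'] at this

/-- Reversing an isolated pair changes the sign of the class. -/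
theorem cls_flip {k : ℕ} {w : List (Letter g)} (hw : w.length = k + 2) {x z : Letter g}
    (hx : Isolated x w) (hz : z ∉ w) (hz' : z.swap ∉ w) (h : TrivialAbove k w) :
    cls k (w.map (Equiv.swap x x.swap)) = - cls k w := by
  have hzx : z ≠ x := by rintro rfl; exact hz hx.mem
  have hzx' : z ≠ x.swap := by rintro rfl; exact hz hx.swap.mem
  have hxz : x ≠ z.swap := by rintro rfl; simp at hzx'
  -- The pair is renamed to `z` and back with `x.swap` as target; the signs multiply to `pairing x
  -- x.swap * pairing x.swap x = -1`.
  have e1 := cls_map_ren hw hx hz hz' h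
  obtain ⟨hxn', hxn⟩ := not_mem_map_ren hz hz' hzx hzx'
  have e2 := cls_map_ren (w := w.map (ren x z)) (by rwa [List.length_map]) (x := z) (y := x.swap)
    (hx.map_ren_left hzx hzx') hxn (by rwa [Sum.swap_swap]) (h.map_ren hzx hzx')
  have a1 : x.swap ≠ z := hzx'.symm
  have a2 : x.swap ≠ z.swap := fun e => hzx (by simpa using congrArg Sum.swap e.symm)
  have e3 : (w.map (ren x z)).map (ren z x.swap) = w.map (Equiv.swap x x.swap) := by
    rw [List.map_map]
    refine List.map_congr_left fun c hc => ?_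
    have c1 : c ≠ z := by rintro rfl; exact hz hc
    have c2 : c ≠ z.swap := by rintro rfl; exact hz' hc
    rw [Function.comp_apply]
    by_cases h1 : c = x
    · rw [h1, ren_left hzx hzx', ren_left a1 a2, Equiv.swap_apply_left]
    by_cases h2 : c = x.swap
    · rw [h2, ren_left_swap hzx hzx', ren_left_swap a1 a2, Equiv.swap_apply_right, Sum.swap_swap]
    rw [ren_of_ne h1 h2 c1 c2, ren_of_ne c1 c2 h2 (by rwa [Sum.swap_swap]),
      Equiv.swap_apply_of_ne_of_ne h1 h2]
  rw [e3, e1, smul_smul, Sum.swap_swap, pairing_comm x x.swap] at e2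
  rw [e2, ← neg_one_smul ℚ (cls k w)]
  congr 1
  linear_combination (-(pairing x x.swap * pairing x x.swap)) * pairing_mul_self z
    - pairing_mul_self x

/-- Exchanging two isolated pairs preserves the class. -/
theorem cls_swap {k : ℕ} {w : List (Letter g)} (hw : w.length = k + 2) {x y z : Letter g}
    (hx : Isolated x w) (hy : Isolated y w) (hyx : y ≠ x) (hyx' : y ≠ x.swap)
    (hz : z ∉ w) (hz' : z.swap ∉ w) (h : TrivialAbove k w) :
    cls k (w.map (ren x y)) = cls k w := by
  have hzx : z ≠ x := by rintro rfl; exact hz hx.mem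
  have hzx' : z ≠ x.swap := by rintro rfl; exact hz hx.swap.mem
  have hyz : y ≠ z := by rintro rfl; exact hz hy.mem
  have hyz' : y ≠ z.swap := by rintro rfl; exact hz' hy.mem
  have hxz : x ≠ z.swap := by rintro rfl; simp at hzx'
  have hxy' : x ≠ y.swap := by rintro rfl; simp at hyx'
  have hzy' : z ≠ y.swap := by rintro rfl; simp at hyz'
  have sw : ∀ {c d : Letter g}, c ≠ d → c.swap ≠ d.swap := fun hcd e =>
    hcd (by simpa using congrArg Sum.swap e)
  -- The fresh index serves as temporary storage: `x` to `z`, `y` to `x`, `z` to `y`. Each sign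
  -- occurs twice.
  have e1 := cls_map_ren hw hx hz hz' h
  obtain ⟨m1, m2⟩ := not_mem_map_ren hz hz' hzx hzx'
  have fy : ren x z y = y := ren_of_ne hyx hyx' hyz hyz'
  have fy' : ren x z y.swap = y.swap :=
    ren_of_ne hxy'.symm (sw hyx) hzy'.symm (sw hyz)
  have i1 := hx.map_ren_left hzx hzx'
  have j1 := hy.map_ren (x := x) (y := z) (by rw [fy, fy'])
  rw [fy] at j1
  have t1 := h.map_ren hzx hzx'
  have e2 := cls_map_ren (w := w.map (ren x z)) (by rwa [List.length_map]) j1 m1 m2 t1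
  obtain ⟨n1, n2⟩ := not_mem_map_ren m1 m2 hyx.symm hxy'
  have fz : ren y x z = z := ren_of_ne hyz.symm hzy' hzx hzx'
  have fz' : ren y x z.swap = z.swap :=
    ren_of_ne hyz'.symm (sw hyz.symm) hxz.symm (sw hzx)
  have i2 := i1.map_ren (x := y) (y := x) (by rw [fz, fz'])
  rw [fz] at i2
  have e3 := cls_map_ren (by rwa [List.length_map, List.length_map]) i2 n1 n2
    (t1.map_ren hyx.symm hxy')
  have e4 : ((w.map (ren x z)).map (ren y x)).map (ren z y) = w.map (ren x y) := by
    rw [List.map_map, List.map_map]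
    refine List.map_congr_left fun c hc => ?_
    have c1 : c ≠ z := by rintro rfl; exact hz hc
    have c2 : c ≠ z.swap := by rintro rfl; exact hz' hc
    simp only [Function.comp_apply]
    by_cases h1 : c = x
    · rw [h1, ren_left hzx hzx', fz, ren_left hyz hyz', ren_left hyx hyx']
    by_cases h2 : c = x.swap
    · rw [h2, ren_left_swap hzx hzx', fz', ren_left_swap hyz hyz', ren_left_swap hyx hyx']
    by_cases h3 : c = y
    · rw [h3, fy, ren_left hyx.symm hxy', ren_of_ne hzx.symm hxz hyx.symm hxy',
        ren_right hyx hyx']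
    by_cases h4 : c = y.swap
    · rw [h4, fy', ren_left_swap hyx.symm hxy', ren_right_swap hyx hyx']
      exact ren_of_ne hzx'.symm (sw hzx.symm) hyx'.symm (sw hyx.symm)
    rw [ren_of_ne h1 h2 c1 c2, ren_of_ne h3 h4 h1 h2, ren_of_ne c1 c2 h3 h4,
      ren_of_ne h1 h2 h3 h4]
  rw [e4, e2, e1, smul_smul, smul_smul] at e3
  rw [e3]
  convert one_smul ℚ _
  linear_combination (pairing x x.swap * pairing x x.swap * (pairing y y.swap * pairing y y.swap)) *
      pairing_mul_self z + (pairing x x.swap * pairing x x.swap) * pairing_mul_self y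
    + pairing_mul_self x

/-! ### The cut relation for classes of words. -/

theorem lie_cycDer_mem_bracketEnds {i j k : ℕ} {u v : List (Letter g)} (hu : u.length = i + 2)
    (hv : v.length = j + 2) (hi : 1 ≤ i) (hj : 1 ≤ j) (hk : i + j = k) :
    ⁅cycDer u, cycDer v⁆ ∈ bracketEnds g k := by
  have h1 := cycDer_mem_sympDeg hu
  have h2 := cycDer_mem_sympDeg hv
  have := lie_mem_bracketEnds hi hj hk h1 h2
  exact this

/-- Cutting a word in two and joining the parts by a fresh pair of letters. -/
theorem cls_add_splitSum {k : ℕ} {u v : List (Letter g)} (hu : 2 ≤ u.length) (hv : 2 ≤ v.length)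
    (hk : u.length + v.length = k + 2) {z : Letter g} (hz : z ∉ u ++ v) (hz' : z.swap ∉ u ++ v) :
    pairing z.swap z • cls k (u ++ v) + splitSum u (fun l x r => splitSum v fun l' s r' =>
      pairing s x • cls k (z.swap :: (l' ++ (r ++ z :: (l ++ r'))))) = 0 := by
  simp only [List.mem_append, not_or] at hz hz'
  have h0 : ⁅cycDer (u ++ [z]), cycDer (z.swap :: v)⁆ ∈ bracketEnds g k :=
    lie_cycDer_mem_bracketEnds (i := u.length - 1) (j := v.length - 1) (by simp; omega)
      (by simp; omega) (by omega) (by omega) (by omega)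
  have h1 := mkQ_lie_cycDer k (u := u ++ [z]) (v := z.swap :: v) (by simp; omega) (by simp; omega)
  rw [Submodule.mkQ_apply, (Submodule.Quotient.mk_eq_zero _).2 h0, splitSum_cons,
    splitSum_append] at h1
  -- The fresh letters pair only with each other. Their contraction gives `u ++ v`; all other terms
  -- contract a letter of `u` with one of `v`.
  have h2 : splitSum u (fun l x r => pairing z.swap x • cls k ((r ++ [z]) ++ (l ++ (v ++ []))))
      = 0 := splitSum_eq_zero (w := u) fun l x r e => by
    rw [pairing_of_ne, zero_smul]
    rintro rfl
    exact hz.1 (by simp [e])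
  rw [h2, zero_add, splitSum_cons, splitSum_nil, add_zero] at h1
  rw [h1, splitSum_comm]
  congr 1
  · simp
  · refine splitSum_congr fun l' s r' e => ?_
    rw [splitSum_append, splitSum_cons, splitSum_nil, add_zero, pairing_of_ne (x := s) (y := z),
      zero_smul, add_zero]
    · refine splitSum_congr fun l x r e' => ?_
      congr 1
      have := cls_append_comm k (r ++ z :: (l ++ r')) (z.swap :: l') (by simp; omega)
      simpa using this.symm
    · rintro rfl
      exact hz'.2 (by simp [e])

open Classical in
/-- Cutting a word: only the isolated pairs that cross the cut contribute. -/
theorem cls_cut {k : ℕ} {u v : List (Letter g)} (hu : 2 ≤ u.length) (hv : 2 ≤ v.length)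
    (hk : u.length + v.length = k + 2) {z : Letter g} (hz : z ∉ u ++ v) (hz' : z.swap ∉ u ++ v)
    (h : TrivialAbove k (u ++ v)) :
    cls k (u ++ v) = splitSum u fun l x r => splitSum v fun l' s r' =>
      if s = x.swap ∧ Isolated x (u ++ v) then cls k (x :: (l' ++ (r ++ s :: (l ++ r')))) else 0 := by
  have key := cls_add_splitSum hu hv hk hz hz'
  set S := splitSum u fun l x r => splitSum v fun l' s r' =>
      if s = x.swap ∧ Isolated x (u ++ v) then cls k (x :: (l' ++ (r ++ s :: (l ++ r')))) else 0
    with hS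
  have e : (splitSum u fun l x r => splitSum v fun l' s r' =>
      pairing s x • cls k (z.swap :: (l' ++ (r ++ z :: (l ++ r')))))
      = -(pairing z.swap z) • S := by
    rw [hS, splitSum_smul]
    refine splitSum_congr fun l x r e1 => ?_
    rw [splitSum_smul]
    refine splitSum_congr fun l' s r' e2 => ?_
    by_cases hs : s = x.swap
    swap
    · rw [pairing_of_ne, zero_smul, if_neg (fun h => hs h.1), smul_zero]
      rintro rfl
      simp at hs
    subst hs
    have hp : (u ++ v).Perm (x :: x.swap :: (l ++ r ++ (l' ++ r'))) := by
      rw [e1, e2]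
      refine (List.perm_middle.append List.perm_middle).trans ?_
      rw [List.cons_append]
      exact List.Perm.cons _ List.perm_middle
    have hlen := hp.length_eq
    simp only [List.length_append, List.length_cons] at hlen
    by_cases hi : Isolated x (u ++ v)
    · rw [if_pos ⟨rfl, hi⟩]
      set t := x :: (l' ++ (r ++ x.swap :: (l ++ r'))) with ht
      have hpt : t.Perm (u ++ v) := by
        refine List.Perm.trans ?_ hp.symm
        refine List.Perm.cons x ?_
        rw [← List.append_assoc]
        refine List.perm_middle.trans (List.Perm.cons _ ?_)
        rw [List.append_assoc, List.append_assoc]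
        refine (List.perm_append_comm_assoc l' r _).trans ?_
        refine (List.Perm.append_left r (List.perm_append_comm_assoc l' l r')).trans ?_
        exact List.perm_append_comm_assoc r l _
      have hxm := hi.mem
      have hxm' := hi.swap.mem
      have hzx : z ≠ x := by rintro rfl; exact hz hxm
      have hzx' : z ≠ x.swap := by rintro rfl; exact hz hxm'
      have d1 : z.swap ≠ x := by rintro rfl; exact hz' hxm
      have d2 : z.swap ≠ x.swap := fun e => hzx (by simpa using congrArg Sum.swap e)
      have hm := cls_map_ren (k := k) (w := t) (y := z.swap) (by simp [ht]; omega) (hi.perm hpt)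
        (fun hc => hz' (hpt.mem_iff.1 hc))
        (fun hc => hz (hpt.mem_iff.1 (by simpa using hc)))
        (fun w' hl hc => h w' hl (by rwa [idxSet_perm hpt] at hc))
      obtain ⟨q, hq, q1, q2⟩ := hi
      have hqq : (l ++ r ++ (l' ++ r')).Perm q := ((hp.symm.trans hq).cons_inv).cons_inv
      have hfix : ∀ p : List (Letter g), (∀ c ∈ p, c ∈ l ++ r ++ (l' ++ r')) →
          p.map (ren x z.swap) = p := by
        intro p hpm
        have hpw : ∀ c ∈ p, c ∈ u ++ v := fun c hc =>
          hp.mem_iff.2 (List.mem_cons_of_mem _ (List.mem_cons_of_mem _ (hpm c hc)))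
        refine map_ren_of_not_mem (fun hc => q1 (hqq.mem_iff.1 (hpm _ hc)))
          (fun hc => q2 (hqq.mem_iff.1 (hpm _ hc))) (fun hc => hz' (hpw _ hc)) (fun hc => ?_)
        rw [Sum.swap_swap] at hc
        exact hz (hpw _ hc)
      have ht' : t.map (ren x z.swap) = z.swap :: (l' ++ (r ++ z :: (l ++ r'))) := by
        rw [ht]
        simp only [List.map_cons, List.map_append]
        rw [ren_left d1 d2, ren_left_swap d1 d2, Sum.swap_swap, hfix l (by simp; tauto),
          hfix l' (by simp; tauto), hfix r (by simp; tauto), hfix r' (by simp; tauto)]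
      rw [← ht', hm, Sum.swap_swap, smul_smul, pairing_comm x x.swap]
      congr 1
      linear_combination -(pairing z.swap z) * pairing_mul_self x
    · rw [if_neg (fun h => hi h.2), smul_zero]
      rw [h.of_ssubset (z := z) (by simp; omega) hz hz', smul_zero]
      intro c hc
      rcases List.mem_cons.1 hc with rfl | hc
      · exact ⟨c, by simp, rfl⟩
      rw [hp.mem_iff, List.mem_cons, List.mem_cons] at hc
      have hx : ∃ y ∈ l ++ r ++ (l' ++ r'), idx y = idx x := by
        by_contra hcon
        exact hi ⟨_, hp, fun hm => hcon ⟨x, hm, rfl⟩,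
          fun hm => hcon ⟨x.swap, hm, idx_eq_iff.2 (Or.inr rfl)⟩⟩
      have hc' : ∃ y ∈ l ++ r ++ (l' ++ r'), idx y = idx c := by
        rcases hc with rfl | rfl | hc
        · exact hx
        · obtain ⟨y, hy, e⟩ := hx
          exact ⟨y, hy, e.trans (idx_eq_iff.2 (Or.inr (by simp)))⟩
        · exact ⟨c, hc, rfl⟩
      obtain ⟨y, hy, e⟩ := hc'
      refine ⟨y, ?_, e⟩
      simp only [List.mem_append, List.mem_cons] at hy ⊢
      tauto
  rw [e, neg_smul, ← sub_eq_add_neg, ← smul_sub] at key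
  have h2 := pairing_mul_self z.swap
  rw [Sum.swap_swap] at h2
  have h3 := congrArg (fun m => pairing z.swap z • m) key
  simp only [smul_smul, h2, one_smul, smul_zero] at h3
  exact sub_eq_zero.1 h3

/-! ### Positions of a word as the letters of a chord functional. -/

theorem splitSum_map {α β M : Type*} [AddCommMonoid M] (ρ : α → β) (w : List α)
    (F : List β → β → List β → M) :
    splitSum (w.map ρ) F = splitSum w fun l x r => F (l.map ρ) (ρ x) (r.map ρ) := by
  induction w generalizing F with
  | nil => rfl
  | cons a w ih => simp [ih]

section Positions

variable {k : ℕ} (ρ : Fin (k + 2) → Letter g)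

/-- The word spelled by all positions. -/
def spell : List (Letter g) := (List.finRange (k + 2)).map ρ

variable {ρ}

theorem Isolated.position_unique {p q : Fin (k + 2)} (h : Isolated (ρ p) (spell ρ))
    (hq : ρ q = ρ p) : q = p := by
  by_contra hne
  obtain ⟨r, h1, h2, -⟩ := h
  have hp1 : (List.finRange (k + 2)).Perm (p :: (List.finRange (k + 2)).erase p) :=
    List.perm_cons_erase (List.mem_finRange p)
  have hq1 : q ∈ (List.finRange (k + 2)).erase p :=
    (List.mem_erase_of_ne hne).2 (List.mem_finRange q)
  have h3 := (((hp1.map ρ).symm.trans h1).cons_inv).mem_iff (a := ρ p)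
  have h4 : ρ p ∈ ((List.finRange (k + 2)).erase p).map ρ := List.mem_map.2 ⟨q, hq1, hq⟩
  rcases List.mem_cons.1 (h3.1 h4) with h5 | h5
  · exact letter_swap_ne _ h5.symm
  · exact h2 h5

theorem Isolated.exists_position {p : Fin (k + 2)} (h : Isolated (ρ p) (spell ρ)) :
    ∃ q, ρ q = (ρ p).swap := by
  obtain ⟨q, -, hq⟩ := List.mem_map.1 h.swap.mem
  exact ⟨q, hq⟩

variable (ρ)

open Classical in
/-- The position of the partner of an isolated letter. -/
def partner (p : Fin (k + 2)) : Fin (k + 2) :=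
  if h : Isolated (ρ p) (spell ρ) then h.exists_position.choose else p

variable {ρ}

theorem Isolated.apply_partner {p : Fin (k + 2)} (h : Isolated (ρ p) (spell ρ)) :
    ρ (partner ρ p) = (ρ p).swap := by
  rw [partner, dif_pos h]
  exact h.exists_position.choose_spec

theorem isolated_of_partner_ne {p : Fin (k + 2)} (h : partner ρ p ≠ p) :
    Isolated (ρ p) (spell ρ) := by
  by_contra h'
  exact h (dif_neg h')

theorem Isolated.eq_partner {p q : Fin (k + 2)} (h : Isolated (ρ p) (spell ρ))
    (hq : ρ q = (ρ p).swap) : q = partner ρ p := by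
  have h1 : Isolated (ρ (partner ρ p)) (spell ρ) := by rw [h.apply_partner]; exact h.swap
  exact h1.position_unique (by rw [hq, h.apply_partner])

theorem partner_partner (p : Fin (k + 2)) : partner ρ (partner ρ p) = p := by
  by_cases h : Isolated (ρ p) (spell ρ)
  · have h1 : Isolated (ρ (partner ρ p)) (spell ρ) := by rw [h.apply_partner]; exact h.swap
    exact (h1.eq_partner (by rw [h.apply_partner, Sum.swap_swap])).symm
  · have : partner ρ p = p := dif_neg h
    rw [this, this]

theorem map_perm_finRange_iff {n : ℕ} (π : Equiv.Perm (Fin n)) (s : List (Fin n)) :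
    (s.map π).Perm (List.finRange n) ↔ s.Perm (List.finRange n) := by
  have h : ((List.finRange n).map π).Perm (List.finRange n) := by
    rw [List.perm_ext_iff_of_nodup ((List.nodup_finRange n).map π.injective) (List.nodup_finRange n)]
    intro a
    simp only [List.mem_finRange, iff_true]
    exact List.mem_map.2 ⟨π.symm a, List.mem_finRange _, π.apply_symm_apply a⟩
  constructor
  · intro hs
    have h1 := hs.trans h.symm
    have h2 := h1.map π.symm
    simpa using h2
  · intro hs
    exact (hs.map π).trans h

theorem spell_perm {s : List (Fin (k + 2))} (hs : s.Perm (List.finRange (k + 2))) :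
    (s.map ρ).Perm (spell ρ) := hs.map ρ

variable (ρ)

open Classical in
/-- The class of the rearrangement of a word that is given by an order of the positions. -/
def positionVal (s : List (Fin (k + 2))) :
    Module.End ℚ (T g) ⧸ bracketEnds g k :=
  if s.Perm (List.finRange (k + 2)) then cls k (s.map ρ) else 0

variable {ρ}

theorem positionVal_of_perm {s : List (Fin (k + 2))} (hs : s.Perm (List.finRange (k + 2))) :
    positionVal ρ s = cls k (s.map ρ) := if_pos hs

theorem perm_of_positionVal_ne {s : List (Fin (k + 2))} (hs : positionVal ρ s ≠ 0) :
    s.Perm (List.finRange (k + 2)) := by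
  by_contra h
  exact hs (if_neg h)

theorem length_map_of_perm {s : List (Fin (k + 2))} (hs : s.Perm (List.finRange (k + 2))) :
    (s.map ρ).length = k + 2 := by
  rw [List.length_map, hs.length_eq, List.length_finRange]

theorem positionVal_congr {s t : List (Fin (k + 2))}
    (h : s.Perm (List.finRange (k + 2)) ↔ t.Perm (List.finRange (k + 2)))
    {c : ℤ} (h' : t.Perm (List.finRange (k + 2)) → cls k (s.map ρ) = c • cls k (t.map ρ)) :
    positionVal ρ s = c • positionVal ρ t := by
  by_cases ht : t.Perm (List.finRange (k + 2))
  · rw [positionVal_of_perm ht, positionVal_of_perm (h.2 ht), h' ht]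
  · rw [positionVal, positionVal, if_neg ht, if_neg (mt h.1 ht), smul_zero]

theorem perm_cut (u' v' l r l' r' : List (Fin (k + 2)))
    (x y : Fin (k + 2)) (h1 : u' = l ++ x :: r) (h2 : v' = l' ++ y :: r') :
    (x :: (l' ++ (r ++ y :: (l ++ r')))).Perm (u' ++ v') := by
  subst h1 h2
  rw [List.perm_iff_count]
  intro a
  simp only [List.count_cons, List.count_append]
  omega

variable (ρ)

/-- The rearrangements of a word form a chord functional if all words with more indices have
trivial class. -/
def positionFunctional (z : Letter g) (hz : z ∉ spell ρ)
    (hz' : z.swap ∉ spell ρ) (h : TrivialAbove k (spell ρ)) :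
    ChordFunctional (Fin (k + 2)) (Module.End ℚ (T g) ⧸ bracketEnds g k) where
  -- Positions stand in for letters because letters may repeat. Isolated pairs become chords; every
  -- other position is free, even if its letter has a partner somewhere.
  bar := partner ρ
  bar_bar := partner_partner
  size := k + 2
  val := positionVal ρ
  nodup_of_ne w hw := (perm_of_positionVal_ne hw).nodup_iff.2 (List.nodup_finRange _)
  mem_of_ne w hw x := (perm_of_positionVal_ne hw).mem_iff.2 (List.mem_finRange x)
  length_of_ne w hw := by rw [(perm_of_positionVal_ne hw).length_eq, List.length_finRange]
  cyc u v := by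
    rw [← one_smul ℤ (positionVal ρ (v ++ u))]
    have hp : (u ++ v).Perm (v ++ u) := List.perm_append_comm
    refine positionVal_congr ⟨hp.symm.trans, hp.trans⟩ fun hs => ?_
    have := length_map_of_perm (ρ := ρ) hs
    rw [one_smul, List.map_append, List.map_append, cls_append_comm]
    rw [← List.map_append, List.length_map, hp.length_eq, ← List.length_map (f := ρ)]
    omega
  cut u v hu hv := by
    by_cases hs : (u ++ v).Perm (List.finRange (k + 2))
    · have hw := spell_perm (ρ := ρ) hs
      have hl := length_map_of_perm (ρ := ρ) hs
      rw [positionVal_of_perm hs]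
      rw [List.map_append] at hw hl ⊢
      rw [cls_cut (z := z) (by rwa [List.length_map]) (by rwa [List.length_map])
        (by rwa [List.length_append] at hl) (fun hc => hz (hw.mem_iff.1 hc))
        (fun hc => hz' (hw.mem_iff.1 hc)) (fun w' h1 h2 => h w' h1 (by rwa [idxSet_perm hw] at h2)),
        splitSum_map]
      refine splitSum_congr fun l x r e1 => ?_
      rw [splitSum_map]
      refine splitSum_congr fun l' y r' e2 => ?_
      -- A free position is its own partner; only because `u` and `v` share no position does `y =
      -- partner ρ x` force `x` to be isolated.
      have hyx : y ≠ x := by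
        rintro rfl
        have hn := hs.nodup_iff.2 (List.nodup_finRange _)
        exact List.disjoint_of_nodup_append hn (a := y) (by simp [e1]) (by simp [e2])
      have hiff : (ρ y = (ρ x).swap ∧ Isolated (ρ x) (u.map ρ ++ v.map ρ)) ↔ y = partner ρ x := by
        constructor
        · rintro ⟨h1, h2⟩
          exact (h2.perm hw.symm).eq_partner h1
        · rintro rfl
          have := isolated_of_partner_ne hyx
          exact ⟨this.apply_partner, this.perm hw⟩
      by_cases hy : y = partner ρ x
      · rw [if_pos (hiff.2 hy), if_pos hy,
          positionVal_of_perm ((perm_cut u v l r l' r' x y e1 e2).trans hs)]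
        simp
      · rw [if_neg (mt hiff.1 hy), if_neg hy]
    · rw [positionVal, if_neg hs]
      refine (splitSum_eq_zero fun l x r e1 => splitSum_eq_zero fun l' y r' e2 => ?_).symm
      split_ifs
      · exact if_neg fun hp => hs ((perm_cut u v l r l' r' x y e1 e2).symm.trans hp)
      · rfl
  relabel x y w hx hy hyx hyx' := by
    rw [← one_smul ℤ (positionVal ρ w)]
    refine positionVal_congr (map_perm_finRange_iff _ _) fun hs => ?_
    have hw := spell_perm (ρ := ρ) hs
    have ix := isolated_of_partner_ne hx
    have iy := isolated_of_partner_ne hy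
    have px := ix.apply_partner
    have py := iy.apply_partner
    have n1 : ρ y ≠ ρ x := fun e => hyx (ix.position_unique e)
    have n2 : ρ y ≠ (ρ x).swap := fun e => hyx' (ix.eq_partner e)
    rw [one_smul, ← cls_swap (length_map_of_perm hs) (ix.perm hw) (iy.perm hw) n1 n2
      (fun hc => hz (hw.mem_iff.1 hc)) (fun hc => hz' (hw.mem_iff.1 hc))
      (fun w' h1 h2 => h w' h1 (by rwa [idxSet_perm hw] at h2)), List.map_map, List.map_map]
    congr 1
    refine List.map_congr_left fun c _ => ?_
    simp only [Function.comp_apply, Equiv.Perm.mul_apply]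
    have m1 : x ≠ partner ρ y := fun e => n2 (by rw [e, py, Sum.swap_swap])
    have m2 : partner ρ y ≠ partner ρ x := fun e => hyx (by
      rw [← partner_partner (ρ := ρ) y, e, partner_partner])
    by_cases h1 : c = x
    · rw [h1, Equiv.swap_apply_of_ne_of_ne hx.symm m1, Equiv.swap_apply_left, ren_left n1 n2]
    by_cases h2 : c = partner ρ x
    · rw [h2, Equiv.swap_apply_left, Equiv.swap_apply_of_ne_of_ne m1.symm hy, px,
        ren_left_swap n1 n2, py]
    by_cases h3 : c = y
    · rw [h3, Equiv.swap_apply_of_ne_of_ne hyx' hy.symm, Equiv.swap_apply_right, ren_right n1 n2]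
    by_cases h4 : c = partner ρ y
    · rw [h4, Equiv.swap_apply_right, Equiv.swap_apply_of_ne_of_ne hx hyx'.symm, py,
        ren_right_swap n1 n2, px]
    rw [Equiv.swap_apply_of_ne_of_ne h2 h4, Equiv.swap_apply_of_ne_of_ne h1 h3,
      ren_of_ne (fun e => h1 (ix.position_unique e)) (fun e => h2 (ix.eq_partner e))
        (fun e => h3 (iy.position_unique e)) (fun e => h4 (iy.eq_partner e))]
  flip x w hx := by
    rw [← neg_one_smul ℤ (positionVal ρ w)]
    refine positionVal_congr (map_perm_finRange_iff _ _) fun hs => ?_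
    have hw := spell_perm (ρ := ρ) hs
    have ix := isolated_of_partner_ne hx
    have px := ix.apply_partner
    rw [neg_one_smul, ← cls_flip (length_map_of_perm hs) (ix.perm hw)
      (fun hc => hz (hw.mem_iff.1 hc)) (fun hc => hz' (hw.mem_iff.1 hc))
      (fun w' h1 h2 => h w' h1 (by rwa [idxSet_perm hw] at h2)), List.map_map, List.map_map]
    congr 1
    refine List.map_congr_left fun c _ => ?_
    simp only [Function.comp_apply]
    by_cases h1 : c = x
    · rw [h1, Equiv.swap_apply_left, Equiv.swap_apply_left, px]
    by_cases h2 : c = partner ρ x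
    · rw [h2, Equiv.swap_apply_right, px, Equiv.swap_apply_right]
    rw [Equiv.swap_apply_of_ne_of_ne h1 h2, Equiv.swap_apply_of_ne_of_ne
      (fun e => h1 (ix.position_unique e)) (fun e => h2 (ix.eq_partner e))]

end Positions

/-! ### Vanishing in the stable range. -/

instance (k : ℕ) : IsAddTorsionFree (Module.End ℚ (T g) ⧸ bracketEnds g k) :=
  .of_module_rat _

/-- In the stable range every cyclic word is a combination of brackets. -/
theorem cls_eq_zero {k : ℕ} (hk : 3 ≤ k) (hg : k + 3 ≤ g) (w : List (Letter g))
    (hw : w.length = k + 2) : cls k w = 0 := by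
  induction hn : k + 2 - (idxSet w).card using Nat.strong_induction_on generalizing w with
  | _ n ih =>
    have hcard : ∀ w' : List (Letter g), w'.length = k + 2 → (idxSet w').card ≤ k + 2 := by
      intro w' hw'
      refine (List.toFinset_card_le _).trans ?_
      rw [List.length_map, hw']
    have hT : TrivialAbove k w := fun w' hw' hc =>
      ih (k + 2 - (idxSet w').card) (by have := hcard w' hw'; omega) w' hw' rfl
    -- A word has at most `k + 2` indices, fewer than `g`.
    obtain ⟨i, hi⟩ : ∃ i, i ∉ idxSet w := by
      by_contra! hcon
      have h1 := Finset.card_le_card (s := Finset.univ) (t := idxSet w) fun i _ => hcon i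
      have h2 := hcard w hw
      rw [Finset.card_univ, Fintype.card_fin] at h1
      omega
    have hz : Sum.inl i ∉ w ∧ (Sum.inl i : Letter g).swap ∉ w := by
      have : idx (Sum.inl i : Letter g) = i := rfl
      rw [← this, idx_mem_idxSet] at hi
      tauto
    obtain ⟨ρ, rfl⟩ : ∃ ρ : Fin (k + 2) → Letter g, spell ρ = w :=
      ⟨fun p => w.get (p.cast hw.symm), by
        subst_vars
        refine List.ext_getElem (by simp [spell, hw]) fun n h1 h2 => ?_
        simp [spell]⟩
    have := (positionFunctional ρ (Sum.inl i) hz.1 hz.2 hT).val_eq_zero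
      (by change 5 ≤ k + 2; omega) (List.finRange (k + 2))
    change positionVal ρ (List.finRange (k + 2)) = 0 at this
    rwa [positionVal_of_perm (List.Perm.refl _)] at this

theorem sympDeg_le_brackets {k : ℕ} (hk : 3 ≤ k) (hg : k + 3 ≤ g) :
    sympDeg g k ≤ brackets g k := by
  intro D hD
  have h := coe_mem_of_cycDer_mem (S := bracketEnds g k) (fun u hu => by
    have := cls_eq_zero hk hg u hu
    rwa [cls, Submodule.mkQ_apply, Submodule.Quotient.mk_eq_zero] at this) hD
  obtain ⟨E, hE, e⟩ := h
  rwa [← Subtype.ext (a1 := E) (a2 := D) e]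

theorem sympDeg_le_sympPos {k : ℕ} (hk : 1 ≤ k) {D : symp g} (hD : D ∈ sympDeg g k) :
    D ∈ sympPos g := by
  obtain ⟨k, rfl⟩ := Nat.exists_eq_succ_of_ne_zero (by omega : k ≠ 0)
  exact Submodule.mem_iSup_of_mem (p := fun k : ℕ => sympDeg g (k + 1)) k hD

/-- From degree `3` on, every element is a combination of brackets of elements of lower positive
degrees, which stay in the stable range. -/
theorem mem_lieSpan_of_mem_sympDeg {k : ℕ} (hk : 1 ≤ k) (hg : k + 3 ≤ g) (D : sympPos g)
    (hD : (D : symp g) ∈ sympDeg g k) :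
    D ∈ LieSubalgebra.lieSpan ℚ (sympPos g)
      {E : sympPos g | (E : symp g) ∈ sympDeg g 1 ∨ (E : symp g) ∈ sympDeg g 2} := by
  induction k using Nat.strong_induction_on generalizing D with
  | _ k ih =>
    set L := LieSubalgebra.lieSpan ℚ (sympPos g)
      {E : sympPos g | (E : symp g) ∈ sympDeg g 1 ∨ (E : symp g) ∈ sympDeg g 2} with hL
    by_cases h3 : 3 ≤ k
    · have key : brackets g k ≤ L.toSubmodule.map (sympPos g).toSubmodule.subtype := by
        refine Submodule.span_le.2 ?_
        rintro F ⟨i, j, hi, hj, hij, A, B, hA, hB, rfl⟩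
        exact ⟨⁅⟨A, sympDeg_le_sympPos hi hA⟩, ⟨B, sympDeg_le_sympPos hj hB⟩⁆,
          L.lie_mem (ih i (by omega) hi (by omega) ⟨A, sympDeg_le_sympPos hi hA⟩ hA)
            (ih j (by omega) hj (by omega) ⟨B, sympDeg_le_sympPos hj hB⟩ hB), rfl⟩
      obtain ⟨E, hE, e⟩ := key (sympDeg_le_brackets h3 hg hD)
      rwa [← Subtype.ext (a1 := E) (a2 := D) e]
    · obtain rfl | rfl : k = 1 ∨ k = 2 := by omega
      · exact LieSubalgebra.subset_lieSpan (Or.inl hD)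
      · exact LieSubalgebra.subset_lieSpan (Or.inr hD)

end SympDer

end

theorem theorem5p1 (g : ℕ) :
    (∀ k : ℕ, 3 ≤ k → k + 3 ≤ g → Subsingleton (SympDer.H1SympPos g k)) ∧
    (∀ k : ℕ, 1 ≤ k → k + 3 ≤ g → ∀ D : SympDer.sympPos g,
      (D : SympDer.symp g) ∈ SympDer.sympDeg g k →
      D ∈ LieSubalgebra.lieSpan ℚ (SympDer.sympPos g)
        {E : SympDer.sympPos g | (E : SympDer.symp g) ∈ SympDer.sympDeg g 1 ∨
          (E : SympDer.symp g) ∈ SympDer.sympDeg g 2}) := by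
  refine ⟨fun k hk hg => ?_, fun k hk hg => SympDer.mem_lieSpan_of_mem_sympDeg hk hg⟩
  rw [Submodule.Quotient.subsingleton_iff, Submodule.submoduleOf, Submodule.comap_subtype_eq_top]
  exact SympDer.sympDeg_le_brackets hk hg
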